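/- **Setting.** Let $\Sigma$ be a linear-time vocabulary: a many-typed first-order vocabulary with a type $\mathit{Time}$ (always interpreted as $\mathbb N$), a constant $\mathcal I$ of type $\mathit{Time}$ (interpreted as $0$) and a function $\mathcal S:\mathit{Time}\to\mathit{Time}$ (interpreted as successor), in which every other symbol has at most one argument of type $\mathit{Time}$ and no other function has output type $\mathit{Time}$. Symbols other than $\mathcal I,\mathcal S$ without a $\mathit{Time}$ argument are *static*, those with one are *dynamic*. The static vocabulary $\Sigma_s$ consists of the static symbols; the single-state vocabulary $\Sigma_{ss}$ adds, for each dynamic $\sigma$, a symbol $\sigma_{\mathrm{cur}}$ without the time argument; the bistate vocabulary $\Sigma_{bs}$ adds to $\Sigma_{ss}$ a further copy $\sigma_{\mathrm{next}}$ of each $\sigma_{\mathrm{cur}}$. An FO(ID) theory consists of a set of first-order sentences and a definition, i.e. a set of rules $\forall\bar x: P(\bar t)\leftarrow\varphi$ or $\forall\bar x: f(\bar t)=t'\leftarrow\varphi$, interpreted by the well-founded semantics (functions being treated through their graphs): a structure satisfies a definition if the well-founded model of the definition over the structure's interpretation of the symbols that occur in no rule head is two-valued and coincides with the structure. A sentence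 or rule is *static* if it contains no terms of type $\mathit{Time}$, and *initial* if its only term of type $\mathit{Time}$ is $\mathcal I$; it is *universal single-state* (respectively *universal bistate*) if it has the form $\forall t:\varphi'$ with $t$ a variable of type $\mathit{Time}$ that is not quantified in $\varphi'$, and its only term of type $\mathit{Time}$ is $t$ (respectively its terms of type $\mathit{Time}$ are among $t$ and $\mathcal S(t)$). For such a universal $\varphi$, $te(\varphi)$ is obtained by dropping the quantification of $t$ and replacing each dynamic $\sigma(\ldots,t)$ by $\sigma_{\mathrm{cur}}(\ldots)$ and each $\sigma(\ldots,\mathcal S(t))$ by $\sigma_{\mathrm{next}}(\ldots)$ (an equation between two of the terms $t$, $\mathcal S(t)$ is replaced by its constant truth value). An *LTC-theory* $\mathcal T$ over $\Sigma$ is an FO(ID) theory all of whose sentences and rules are static, initial, universal single-state or universal bistate, and whose definition is stratified over time: no rule defines $\mathcal I$ or $\mathcal S$, no rule with a head atom at $t$ contains $\mathcal S(t)$, and no rule whose head has a static symbol contains a variable of type $\mathit{Time}$. Its *initial theory* $\mathcal T_0$ over $\Sigma_{ss}$ consists of the static members of $\mathcal T$, the $te(\forall t:\varphi[t/\mathcal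 I])$ for initial $\varphi\in\mathcal T$, and the $te(\varphi)$ for single-state $\varphi\in\mathcal T$. Its *transition theory* $\mathcal T_t$ over $\Sigma_{bs}$ consists of the static members of $\mathcal T$, the $te(\varphi)$ and $te(\varphi[\mathcal S(t)/t])$ for single-state $\varphi\in\mathcal T$, and the $te(\varphi)$ for bistate $\varphi\in\mathcal T$. **Theorem.** Let $\mathcal T$ be an LTC-theory in which a symbol in the head of a static rule occurs in the heads of static rules only, and a symbol in the head of a single-state rule occurs in the heads of single-state rules only. Let $I$ be a $\Sigma_s$-structure and let $\varphi$ be a universal single-state sentence over $\Sigma$ with time variable $t$. Suppose that $\mathcal T_0\wedge\neg te(\varphi)$ has no model expanding $I$ and that $\mathcal T_t\wedge te(\varphi)\wedge\neg te(\varphi[\mathcal S(t)/t])$ has no model expanding $I$. Then $\varphi$ is satisfied in every $\Sigma$-structure that expands $I$ and is a model of $\mathcal T$. -/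

import Mathlib

/-! Many-typed FO(ID): first-order logic with definitions under the well-founded semantics. -/

universe u w

namespace LTC

/-- A many-typed first-order vocabulary with set of types `S`: each predicate symbol and each
function symbol has finitely many typed argument positions, and each function symbol has an
output type. -/
structure Voc (S : Type u) where
  Rel : Type u
  relPos : Rel → Type
  relFin : ∀ p, Finite (relPos p)
  relTy : ∀ p, relPos p → S
  Fn : Type u
  fnPos : Fn → Type
  fnFin : ∀ f, Finite (fnPos f)
  fnTy : ∀ f, fnPos f → S
  fnOut : Fn → S

section Formulas

variable {S : Type u}

/-- Typed terms. For each type `s` the variables of type `s` are numbered by `ℕ`. -/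
inductive Term (V : Voc S) : S → Type u
  | var (s : S) (n : ℕ) : Term V s
  | app (f : V.Fn) (args : ∀ i : V.fnPos f, Term V (V.fnTy f i)) : Term V (V.fnOut f)

/-- First-order formulas; the remaining connectives and the existential quantifier are the
usual abbreviations. -/
inductive Formula (V : Voc S) : Type u
  | top : Formula V
  | rel (p : V.Rel) (args : ∀ i : V.relPos p, Term V (V.relTy p i)) : Formula V
  | eq (s : S) (a b : Term V s) : Formula V
  | neg (φ : Formula V) : Formula V
  | and (φ ψ : Formula V) : Formula V
  | all (s : S) (n : ℕ) (φ : Formula V) : Formula V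

/-- Rule heads: `P(t̄)` or `f(t̄) = t'`. -/
inductive Head (V : Voc S) : Type u
  | rel (p : V.Rel) (args : ∀ i : V.relPos p, Term V (V.relTy p i)) : Head V
  | fn (f : V.Fn) (args : ∀ i : V.fnPos f, Term V (V.fnTy f i)) (val : Term V (V.fnOut f)) : Head V

/-- A rule `∀ x̄ : head ← body`, where `x̄` are all the variables free in the head or the body. -/
structure Rule (V : Voc S) where
  head : Head V
  body : Formula V

/-- An FO(ID) theory: a set of sentences and a definition (a set of rules). That the
members of `sentences` are closed is required where it is used. -/
structure Theory (V : Voc S) where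
  sentences : Set (Formula V)
  rules : Set (Rule V)

variable {V : Voc S}

/-- The conjunction of a theory with a sentence. -/
def Theory.and (T : Theory V) (φ : Formula V) : Theory V :=
  ⟨insert φ T.sentences, T.rules⟩

def Term.vars : {s : S} → Term V s → Set (S × ℕ)
  | _, .var s n => {(s, n)}
  | _, .app _ a => ⋃ i, (a i).vars

def Formula.freeVars : Formula V → Set (S × ℕ)
  | .top => ∅
  | .rel _ a => ⋃ i, (a i).vars
  | .eq _ a b => a.vars ∪ b.vars
  | .neg φ => φ.freeVars
  | .and φ ψ => φ.freeVars ∪ ψ.freeVars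
  | .all s n φ => φ.freeVars \ {(s, n)}

/-- The variables that are quantified somewhere in the formula. -/
def Formula.boundVars : Formula V → Set (S × ℕ)
  | .top => ∅
  | .rel _ _ => ∅
  | .eq _ _ _ => ∅
  | .neg φ => φ.boundVars
  | .and φ ψ => φ.boundVars ∪ ψ.boundVars
  | .all s n φ => insert (s, n) φ.boundVars

def Formula.IsSentence (φ : Formula V) : Prop := φ.freeVars = ∅

/-- The symbol that a rule head defines. -/
def Head.symbol : Head V → V.Rel ⊕ V.Fn
  | .rel p _ => .inl p
  | .fn f _ _ => .inr f

end Formulas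

section Semantics

variable {S : Type u}

structure Str (V : Voc S) where
  dom : S → Type w
  nonempty : ∀ s, Nonempty (dom s)
  rel : ∀ p : V.Rel, (∀ i, dom (V.relTy p i)) → Prop
  fn : ∀ f : V.Fn, (∀ i, dom (V.fnTy f i)) → dom (V.fnOut f)

variable {V : Voc S} (M : Str.{u, w} V)

/-- Variable assignments. -/
abbrev Str.Val : Type (max u w) := ∀ s : S, ℕ → M.dom s

variable {M}

open Classical in
noncomputable def Str.Val.set (v : M.Val) (s : S) (n : ℕ) (d : M.dom s) : M.Val :=
  Function.update v s (Function.update (v s) n d)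

def Term.val (v : M.Val) : {s : S} → Term V s → M.dom s
  | _, .var s n => v s n
  | _, .app f a => M.fn f fun i => (a i).val v

/-- Tarskian truth of a formula under an assignment. -/
def Formula.Sat : M.Val → Formula V → Prop
  | _, .top => True
  | v, .rel p a => M.rel p fun i => (a i).val v
  | v, .eq _ a b => a.val v = b.val v
  | v, .neg φ => ¬ φ.Sat v
  | v, .and φ ψ => φ.Sat v ∧ ψ.Sat v
  | v, .all s n φ => ∀ d : M.dom s, φ.Sat (v.set s n d)

/-- A structure satisfies a sentence. -/
def Str.Models (M : Str.{u, w} V) (φ : Formula V) : Prop := ∀ v : M.Val, φ.Sat v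

/-- Domain atoms: `P(d̄)` and, function symbols being treated through their graphs,
`f(d̄) = d`. -/
inductive Atom (M : Str.{u, w} V) : Type (max u w)
  | rel (p : V.Rel) (x : ∀ i, M.dom (V.relTy p i)) : Atom M
  | fn (f : V.Fn) (x : ∀ i, M.dom (V.fnTy f i)) (d : M.dom (V.fnOut f)) : Atom M

def Atom.symbol : Atom M → V.Rel ⊕ V.Fn
  | .rel p _ => .inl p
  | .fn f _ _ => .inr f

/-- The domain atoms that are true in `M`. -/
def Str.atoms (M : Str.{u, w} V) : Set (Atom M) :=
  {a | match a with
    | .rel p x => M.rel p x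
    | .fn f x d => M.fn f x = d}

/-- `t` has value `d`, where function symbols are read off from a set of atoms. -/
def Term.Graph (A : Set (Atom M)) (v : M.Val) : {s : S} → Term V s → M.dom s → Prop
  | _, .var s n, d => d = v s n
  | _, .app f a, d => ∃ x, (∀ i, (a i).Graph A v (x i)) ∧ Atom.fn f x d ∈ A

/-- Truth of a formula where positive occurrences of atoms are evaluated in `P` and negative
occurrences in `N`; an atom `Q(f(t))` is read as `∃ y, Graph_f(t, y) ∧ Q(y)`. With `P ⊆ N`
(lower and upper bounds) this says that the Kleene value is "true". -/
def Formula.Holds : Set (Atom M) → Set (Atom M) → M.Val → Formula V → Prop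
  | _, _, _, .top => True
  | P, _, v, .rel p a => ∃ x, (∀ i, (a i).Graph P v (x i)) ∧ Atom.rel p x ∈ P
  | P, _, v, .eq _ a b => ∃ d, a.Graph P v d ∧ b.Graph P v d
  | P, N, v, .neg φ => ¬ φ.Holds N P v
  | P, N, v, .and φ ψ => φ.Holds P N v ∧ ψ.Holds P N v
  | P, N, v, .all s n φ => ∀ d : M.dom s, φ.Holds P N (v.set s n d)

/-- The instance of a rule head under an assignment is the domain atom `a`. -/
def Head.Instance (P : Set (Atom M)) (v : M.Val) : Head V → Atom M → Prop
  | .rel p t, a => ∃ x, (∀ i, (t i).Graph P v (x i)) ∧ a = .rel p x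
  | .fn f t b, a => ∃ x d, (∀ i, (t i).Graph P v (x i)) ∧ b.Graph P v d ∧ a = .fn f x d

/-- A symbol is defined by `Δ` if it occurs in the head of a rule; otherwise it is open. -/
def Defined (Δ : Set (Rule V)) (σ : V.Rel ⊕ V.Fn) : Prop := ∃ r ∈ Δ, r.head.symbol = σ

/-- Immediate consequences: atoms of open symbols keep their value in `M`, atoms of defined
symbols are derived by a rule instance whose body holds. -/
def derive (Δ : Set (Rule V)) (P N : Set (Atom M)) : Set (Atom M) :=
  {a | (¬ Defined Δ a.symbol ∧ a ∈ M.atoms) ∨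
    ∃ r ∈ Δ, ∃ v : M.Val, r.head.Instance P v a ∧ r.body.Holds P N v}

/-- The stable operator: the least set closed under `derive Δ · N`. -/
def stable (Δ : Set (Rule V)) (N : Set (Atom M)) : Set (Atom M) :=
  ⋂₀ {P | derive Δ P N ⊆ P}

/-- The atoms true in the well-founded model of `Δ` over the open part of `M`: the least
fixpoint of the (monotone) square of the stable operator. -/
def wellFoundedTrue (M : Str.{u, w} V) (Δ : Set (Rule V)) : Set (Atom M) :=
  ⋂₀ {P | stable Δ (stable Δ P) ⊆ P}

/-- The atoms true or unknown in the well-founded model. -/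
def wellFoundedPossible (M : Str.{u, w} V) (Δ : Set (Rule V)) : Set (Atom M) :=
  stable Δ (wellFoundedTrue M Δ)

/-- `M` satisfies the definition `Δ`: the well-founded model over the open part of `M` is
two-valued and is `M` itself. -/
def Str.ModelsDef (M : Str.{u, w} V) (Δ : Set (Rule V)) : Prop :=
  wellFoundedTrue M Δ = M.atoms ∧ wellFoundedPossible M Δ = M.atoms

def Str.ModelsTheory (M : Str.{u, w} V) (T : Theory V) : Prop :=
  (∀ φ ∈ T.sentences, M.Models φ) ∧ M.ModelsDef T.rules

end Semantics

/-! Linear-time vocabularies, the derived vocabularies and their structures. -/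

/-- A linear-time vocabulary: its types other than `Time`, its static symbols and its dynamic
symbols. For a dynamic symbol only the arguments other than the (single) argument of type
`Time` are listed, i.e. `dynamic` is the vocabulary of the projected symbols. -/
structure LTVoc where
  Ty : Type u
  static : Voc Ty
  dynamic : Voc Ty

variable (V : LTVoc.{u})

inductive FullRel : Type u
  | static (p : V.static.Rel)
  | dyn (p : V.dynamic.Rel)

/-- Function symbols: the constant for the initial time point, the successor, and the static
and dynamic ones. -/
inductive FullFn : Type u
  | init
  | succ
  | static (f : V.static.Fn)
  | dyn (f : V.dynamic.Fn)

/-- The linear-time vocabulary as a many-typed vocabulary: the type `none` is `Time`, and a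
dynamic symbol has the argument position `none`, of type `Time`, besides its other ones. -/
def LTVoc.full : Voc (Option V.Ty) where
  Rel := FullRel V
  relPos
    | .static p => V.static.relPos p
    | .dyn p => Option (V.dynamic.relPos p)
  relFin
    | .static p => V.static.relFin p
    | .dyn p => by have := V.dynamic.relFin p; dsimp only; infer_instance
  relTy
    | .static p => fun i => some (V.static.relTy p i)
    | .dyn p => fun i => i.map (V.dynamic.relTy p)
  Fn := FullFn V
  fnPos
    | .init => Empty
    | .succ => Unit
    | .static f => V.static.fnPos f
    | .dyn f => Option (V.dynamic.fnPos f)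
  fnFin
    | .init => by dsimp only; infer_instance
    | .succ => by dsimp only; infer_instance
    | .static f => V.static.fnFin f
    | .dyn f => by have := V.dynamic.fnFin f; dsimp only; infer_instance
  fnTy
    | .init => Empty.elim
    | .succ => fun _ => none
    | .static f => fun i => some (V.static.fnTy f i)
    | .dyn f => fun i => i.map (V.dynamic.fnTy f)
  fnOut
    | .init => none
    | .succ => none
    | .static f => some (V.static.fnOut f)
    | .dyn f => some (V.dynamic.fnOut f)

inductive StateRel (K : Type) : Type u
  | static (p : V.static.Rel)
  | dyn (p : V.dynamic.Rel) (k : K)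

inductive StateFn (K : Type) : Type u
  | static (f : V.static.Fn)
  | dyn (f : V.dynamic.Fn) (k : K)

/-- The static symbols together with one copy, indexed by each `k : K`, of every projected
dynamic symbol. (`Time`, to which no symbol of such a vocabulary refers, is left out.) -/
def LTVoc.state (K : Type) : Voc V.Ty where
  Rel := StateRel V K
  relPos
    | .static p => V.static.relPos p
    | .dyn p _ => V.dynamic.relPos p
  relFin
    | .static p => V.static.relFin p
    | .dyn p _ => V.dynamic.relFin p
  relTy
    | .static p => V.static.relTy p
    | .dyn p _ => V.dynamic.relTy p
  Fn := StateFn V K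
  fnPos
    | .static f => V.static.fnPos f
    | .dyn f _ => V.dynamic.fnPos f
  fnFin
    | .static f => V.static.fnFin f
    | .dyn f _ => V.dynamic.fnFin f
  fnTy
    | .static f => V.static.fnTy f
    | .dyn f _ => V.dynamic.fnTy f
  fnOut
    | .static f => V.static.fnOut f
    | .dyn f _ => V.dynamic.fnOut f

/-- The current state and the next state. -/
inductive Step : Type
  | cur
  | next

/-- The single-state vocabulary. -/
abbrev LTVoc.single : Voc V.Ty := V.state Unit

/-- The bistate vocabulary: the copies `cur` are the projected symbols, the copies `next` are
the next-state symbols. -/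
abbrev LTVoc.bi : Voc V.Ty := V.state Step

variable {V}

/-- The restriction of a single-state or bistate structure to the static vocabulary. -/
def Str.reduct {K : Type} (M : Str.{u, w} (V.state K)) : Str.{u, w} V.static where
  dom := M.dom
  nonempty := M.nonempty
  rel p x := M.rel (.static p) x
  fn f x := M.fn (.static f) x

/-- A single-state or bistate structure expands a static one. -/
def Str.Expands {K : Type} (M : Str.{u, w} (V.state K)) (I : Str.{u, w} V.static) : Prop :=
  M.reduct = I

variable (V) in
/-- A structure of a linear-time vocabulary: an interpretation of the types other than `Time`
and of the static symbols, and one of the dynamic symbols, with time ranging over `ℕ`. -/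
structure TimeStr where
  base : Str.{u, w} V.static
  rel : ∀ p : V.dynamic.Rel, (∀ i, base.dom (V.dynamic.relTy p i)) → ℕ → Prop
  fn : ∀ f : V.dynamic.Fn, (∀ i, base.dom (V.dynamic.fnTy f i)) → ℕ → base.dom (V.dynamic.fnOut f)

/-- The domains: `Time` is (a copy in the right universe of) `ℕ`. -/
def TimeStr.dom (J : TimeStr.{u, w} V) : Option V.Ty → Type w
  | none => ULift.{w} ℕ
  | some s => J.base.dom s

/-- The underlying many-typed structure: `Time` is `ℕ`, the initial time point is `0`, and the
successor symbol is the successor function. -/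
def TimeStr.toStr (J : TimeStr.{u, w} V) : Str.{u, w} V.full where
  dom := J.dom
  nonempty
    | none => ⟨(⟨0⟩ : ULift.{w} ℕ)⟩
    | some s => J.base.nonempty s
  rel
    | .static p => fun x => J.base.rel p x
    | .dyn p => fun x => J.rel p (fun i => x (some i)) (ULift.down (x none))
  fn
    | .init => fun _ => (⟨0⟩ : ULift.{w} ℕ)
    | .succ => fun x => (⟨ULift.down (x ()) + 1⟩ : ULift.{w} ℕ)
    | .static f => fun x => J.base.fn f x
    | .dyn f => fun x => J.fn f (fun i => x (some i)) (ULift.down (x none))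

/-- A structure of the linear-time vocabulary expands a static one. -/
def TimeStr.Expands (J : TimeStr.{u, w} V) (I : Str.{u, w} V.static) : Prop := J.base = I

/-! Time terms, substitution of time terms, and the syntactic classes. -/

/-- Terms of type `Time`. -/
abbrev TimeTerm (V : LTVoc.{u}) : Type u := Term V.full none

/-- The time variable number `t`. -/
abbrev timeVar (t : ℕ) : TimeTerm V := .var none t

/-- The constant for the initial time point. -/
def initial : TimeTerm V := .app (V := V.full) FullFn.init fun i => Empty.elim i

/-- The successor of a time term. -/
def successor (τ : TimeTerm V) : TimeTerm V := .app (V := V.full) FullFn.succ fun _ => τ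

def Term.self : {s : Option V.Ty} → Term V.full s → Set (TimeTerm V)
  | none, τ => {τ}
  | some _, _ => ∅

/-- All terms of type `Time` that occur in a term. -/
def Term.timeTerms : {s : Option V.Ty} → Term V.full s → Set (TimeTerm V)
  | _, .var s n => Term.self (.var s n)
  | _, .app f a => Term.self (.app f a) ∪ ⋃ i, (a i).timeTerms

/-- All terms of type `Time` that occur in a formula, the quantified time variables included. -/
def Formula.timeTerms : Formula V.full → Set (TimeTerm V)
  | .top => ∅
  | .rel _ a => ⋃ i, (a i).timeTerms
  | .eq _ a b => a.timeTerms ∪ b.timeTerms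
  | .neg φ => φ.timeTerms
  | .and φ ψ => φ.timeTerms ∪ ψ.timeTerms
  | .all s n φ => Term.self (.var s n) ∪ φ.timeTerms

def Head.timeTerms : Head V.full → Set (TimeTerm V)
  | .rel _ a => ⋃ i, (a i).timeTerms
  | .fn f a b => (Term.app f a).timeTerms ∪ b.timeTerms

def Rule.timeTerms (r : Rule V.full) : Set (TimeTerm V) :=
  r.head.timeTerms ∪ r.body.timeTerms

/-- Replace every occurrence of the initial time point by `ι` and every occurrence of a time
variable `n` in a term by `ρ n`. -/
def Term.timeSubst (ι : TimeTerm V) (ρ : ℕ → TimeTerm V) :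
    {s : Option V.Ty} → Term V.full s → Term V.full s
  | _, .var none n => ρ n
  | _, .var (some s) n => .var (some s) n
  | _, .app f a =>
    let b := fun i => Term.timeSubst ι ρ (a i)
    match f, b with
    | .init, _ => ι
    | .succ, b => .app (V := V.full) FullFn.succ b
    | .static f, b => .app (V := V.full) (FullFn.static f) b
    | .dyn f, b => .app (V := V.full) (FullFn.dyn f) b

def Formula.timeSubst (ι : TimeTerm V) (ρ : ℕ → TimeTerm V) : Formula V.full → Formula V.full
  | .top => .top
  | .rel p a => .rel p fun i => Term.timeSubst ι ρ (a i)
  | .eq s a b => .eq s (Term.timeSubst ι ρ a) (Term.timeSubst ι ρ b)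
  | .neg φ => .neg (φ.timeSubst ι ρ)
  | .and φ ψ => .and (φ.timeSubst ι ρ) (ψ.timeSubst ι ρ)
  | .all s n φ => .all s n (φ.timeSubst ι ρ)

def Rule.timeSubst (ι : TimeTerm V) (ρ : ℕ → TimeTerm V) (r : Rule V.full) : Rule V.full where
  head := match r.head with
    | .rel p a => .rel p fun i => Term.timeSubst ι ρ (a i)
    | .fn f a b => .fn f (fun i => Term.timeSubst ι ρ (a i)) (Term.timeSubst ι ρ b)
  body := r.body.timeSubst ι ρ

/-- The replacement of the time variable `t` by its successor. -/
def shift (t n : ℕ) : TimeTerm V := if n = t then successor (timeVar t) else timeVar n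

/-- `φ[S(t)/t]`. -/
def Formula.atNext (t : ℕ) (φ : Formula V.full) : Formula V.full := φ.timeSubst initial (shift t)

def Rule.atNext (t : ℕ) (r : Rule V.full) : Rule V.full := r.timeSubst initial (shift t)

/-- `φ[t/I]` for the initial time point `I`. -/
def Formula.initTo (t : ℕ) (φ : Formula V.full) : Formula V.full :=
  φ.timeSubst (timeVar t) timeVar

def Rule.initTo (t : ℕ) (r : Rule V.full) : Rule V.full := r.timeSubst (timeVar t) timeVar

def Formula.IsStatic (φ : Formula V.full) : Prop := φ.timeTerms = ∅

def Formula.IsInitial (φ : Formula V.full) : Prop := φ.timeTerms = {initial}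

/-- `φ` is `∀ t : φ'` with `t` not quantified in `φ'`. -/
def Formula.IsUniversal (t : ℕ) (φ : Formula V.full) : Prop :=
  ∃ φ', φ = .all none t φ' ∧ (none, t) ∉ φ'.boundVars

/-- Universal single-state formulas with time variable `t`. -/
def Formula.IsSingleState (t : ℕ) (φ : Formula V.full) : Prop :=
  φ.IsUniversal t ∧ φ.timeTerms = {timeVar t}

/-- Universal bistate formulas with time variable `t`. -/
def Formula.IsBistate (t : ℕ) (φ : Formula V.full) : Prop :=
  φ.IsUniversal t ∧ timeVar t ∈ φ.timeTerms ∧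
    φ.timeTerms ⊆ {timeVar t, successor (timeVar t)}

def Rule.IsStatic (r : Rule V.full) : Prop := r.timeTerms = ∅

def Rule.IsInitial (r : Rule V.full) : Prop := r.timeTerms = {initial}

/-- Universal single-state rules with time variable `t`. -/
def Rule.IsSingleState (t : ℕ) (r : Rule V.full) : Prop :=
  (none, t) ∉ r.body.boundVars ∧ r.timeTerms = {timeVar t}

/-- Universal bistate rules with time variable `t`. -/
def Rule.IsBistate (t : ℕ) (r : Rule V.full) : Prop :=
  (none, t) ∉ r.body.boundVars ∧ timeVar t ∈ r.timeTerms ∧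
    r.timeTerms ⊆ {timeVar t, successor (timeVar t)}

/-- A rule respects the order of time if it defines no atom in terms of future values: a rule
for an atom at `t` does not refer to `S(t)`, and a rule for a static atom (which belongs to
every state, the initial one included) does not refer to a time variable. The symbols with a
fixed interpretation (initial time point, successor) are not defined at all. -/
def Rule.RespectsTime (r : Rule V.full) : Prop :=
  match r.head with
  | .rel (.static _) _ => ∀ n, timeVar n ∉ r.timeTerms
  | .rel (.dyn _) a => ∀ n, a none = timeVar n → successor (timeVar n) ∉ r.timeTerms
  | .fn .init _ _ => False
  | .fn .succ _ _ => False
  | .fn (.static _) _ _ => ∀ n, timeVar n ∉ r.timeTerms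
  | .fn (.dyn _) a _ => ∀ n, a none = timeVar n → successor (timeVar n) ∉ r.timeTerms

/-- LTC-theories: all sentences and rules are static, initial, universal single-state or
universal bistate, and the definition is stratified over time. -/
structure Theory.IsLTC (T : Theory V.full) : Prop where
  closed : ∀ φ ∈ T.sentences, φ.IsSentence
  sentences : ∀ φ ∈ T.sentences,
    φ.IsStatic ∨ φ.IsInitial ∨ (∃ t, φ.IsSingleState t) ∨ ∃ t, φ.IsBistate t
  rules : ∀ r ∈ T.rules,
    r.IsStatic ∨ r.IsInitial ∨ (∃ t, r.IsSingleState t) ∨ ∃ t, r.IsBistate t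
  stratified : ∀ r ∈ T.rules, r.RespectsTime

/-- Rules for the same symbol are of the same kind: a symbol with a static rule has only static
rules, and a symbol with a single-state rule has only single-state rules. (Initial and
bistate rules may be combined.) -/
def Theory.SeparatesRules (T : Theory V.full) : Prop :=
  ∀ r ∈ T.rules, ∀ r' ∈ T.rules, r.head.symbol = r'.head.symbol →
    (r.IsStatic → r'.IsStatic) ∧ ((∃ t, r.IsSingleState t) → ∃ t, r'.IsSingleState t)

/-! Elimination of time, the initial theory and the transition theory. -/

section Elimination

variable {K : Type} (κ : Step → K)

/-- What a term becomes: a time term becomes `cur` or `next`, any other term a term over the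
state vocabulary. -/
def Elim (V : LTVoc.{u}) (K : Type) : Option V.Ty → Type u
  | none => ULift.{u} Step
  | some s => Term (V.state K) s

/-- Elimination of time in terms, where the copies `κ cur` and `κ next` of the dynamic symbols
take the place of a time argument `t` and `S(t)` respectively. -/
def Term.te : {s : Option V.Ty} → Term V.full s → Elim V K s
  | _, .var none _ => (⟨.cur⟩ : ULift.{u} Step)
  | _, .var (some s) n => (.var s n : Term (V.state K) s)
  | _, .app f a =>
    let b := fun i => (a i).te
    match f, b with
    | .init, _ => (⟨.cur⟩ : ULift.{u} Step)
    | .succ, _ => (⟨.next⟩ : ULift.{u} Step)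
    | .static f, b => Term.app (V := V.state K) (StateFn.static f) b
    | .dyn f, b =>
      Term.app (V := V.state K) (StateFn.dyn f (κ (ULift.down (b none)))) fun i => b (some i)

/-- An equation between time terms is true or false independently of the time point. -/
def teTimeEq : Step → Step → Formula (V.state K)
  | .cur, .cur => .top
  | .next, .next => .top
  | .cur, .next => .neg .top
  | .next, .cur => .neg .top

/-- Elimination of time in formulas; the quantification of the time variable is dropped. -/
def Formula.te : Formula V.full → Formula (V.state K)
  | .top => .top
  | .rel (.static p) a => .rel (V := V.state K) (StateRel.static p) fun i => (a i).te κ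
  | .rel (.dyn p) a =>
    .rel (V := V.state K) (StateRel.dyn p (κ (ULift.down ((a none).te κ))))
      fun i => (a (some i)).te κ
  | .eq none a b => teTimeEq (ULift.down (a.te κ)) (ULift.down (b.te κ))
  | .eq (some s) a b => .eq s (a.te κ) (b.te κ)
  | .neg φ => .neg φ.te
  | .and φ ψ => .and φ.te ψ.te
  | .all none _ φ => φ.te
  | .all (some s) n φ => .all s n φ.te

/-- Elimination of time in rule heads; it is only meaningful for heads with a static or a
dynamic symbol, and the value `none` (for the initial time point and the successor) does not
arise in LTC-theories. -/
def Head.te : Head V.full → Option (Head (V.state K))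
  | .rel (.static p) a =>
    some (.rel (V := V.state K) (StateRel.static p) fun i => (a i).te κ)
  | .rel (.dyn p) a =>
    some (.rel (V := V.state K) (StateRel.dyn p (κ (ULift.down ((a none).te κ))))
      fun i => (a (some i)).te κ)
  | .fn .init _ _ => none
  | .fn .succ _ _ => none
  | .fn (.static f) a b =>
    some (.fn (V := V.state K) (StateFn.static f) (fun i => (a i).te κ) (b.te κ))
  | .fn (.dyn f) a b =>
    some (.fn (V := V.state K) (StateFn.dyn f (κ (ULift.down ((a none).te κ))))
      (fun i => (a (some i)).te κ) (b.te κ))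

/-- Elimination of time in rules. -/
def Rule.te (r : Rule V.full) : Option (Rule (V.state K)) :=
  (r.head.te κ).map fun h => ⟨h, r.body.te κ⟩

end Elimination

/-- Time-elimination of a single-state sentence, as a sentence over the single-state
vocabulary. -/
def Formula.teSingle (φ : Formula V.full) : Formula V.single := φ.te fun _ => ()

def Rule.teSingle (r : Rule V.full) : Option (Rule V.single) := r.te fun _ => ()

/-- Time-elimination as a sentence over the bistate vocabulary. -/
def Formula.teBi (φ : Formula V.full) : Formula V.bi := φ.te id

def Rule.teBi (r : Rule V.full) : Option (Rule V.bi) := r.te id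

/-- The initial theory. (Elimination of time leaves static sentences and rules unchanged.) -/
def Theory.initialTheory (T : Theory V.full) : Theory V.single where
  sentences := {ψ | ∃ φ ∈ T.sentences,
    (φ.IsStatic ∧ ψ = φ.teSingle) ∨
    (φ.IsInitial ∧ ψ = (Formula.all none 0 (φ.initTo 0)).teSingle) ∨
    ((∃ t, φ.IsSingleState t) ∧ ψ = φ.teSingle)}
  rules := {r' | ∃ r ∈ T.rules,
    (r.IsStatic ∧ r.teSingle = some r') ∨
    (r.IsInitial ∧ (r.initTo 0).teSingle = some r') ∨
    ((∃ t, r.IsSingleState t) ∧ r.teSingle = some r')}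

/-- The transition theory. -/
def Theory.transitionTheory (T : Theory V.full) : Theory V.bi where
  sentences := {ψ | ∃ φ ∈ T.sentences,
    (φ.IsStatic ∧ ψ = φ.teBi) ∨
    (∃ t, φ.IsSingleState t ∧ (ψ = φ.teBi ∨ ψ = (φ.atNext t).teBi)) ∨
    ((∃ t, φ.IsBistate t) ∧ ψ = φ.teBi)}
  rules := {r' | ∃ r ∈ T.rules,
    (r.IsStatic ∧ r.teBi = some r') ∨
    (∃ t, r.IsSingleState t ∧ (r.teBi = some r' ∨ (r.atNext t).teBi = some r')) ∨
    ((∃ t, r.IsBistate t) ∧ r.teBi = some r')}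

end LTC

/-! The proof is an induction on time. Let `J` be a model of `T` expanding `I`. Freezing `J` at time
0 gives a single-state structure, and freezing it at `k` and `k + 1` gives a bistate structure; both
expand `I`. Once these are known to be models of the initial and of the transition theory, the first
hypothesis rules out that `φ` fails at 0, and the second that it holds at `k` and fails at `k + 1`.

For sentences this amounts to evaluating time terms (`Formula.sat_te_iff`). The difficulty is the
definition: a well-founded model over all of `ℕ` has to be compared with one over a single state or
two. The domain atoms of a frozen structure embed into those of `J` by `liftAtom`, and
`Str.ModelsDef.transfer` reduces the comparison to single derivation steps. Every application of an
eliminated rule must lift to a derivation in `J`; conversely, a true atom of the frozen structure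
whose lift is derived in `J` must be derived by an eliminated rule or be open.

Rules with a counterpart in the eliminated theory are handled by `Rule.apply_te_iff`. The others are
harmless. By stratification a rule mentioning `S(t)` has its head at `S(t)`, so it derives nothing
at time 0 and may be dropped from the initial theory. The transition theory loses the initial rules
and the bistate derivations of atoms at `k`; since rule kinds are separated, the symbols of those
atoms are open there (`not_defined_transitionTheory`), and open atoms keep the value they have in
`J`. -/

namespace LTC

/-! ### Stable operators, well-founded models and their transfer -/

section WellFounded

variable {S : Type u} {V : Voc S} {M : Str.{u, w} V}

theorem Term.Graph.mono {P P' : Set (Atom M)} (hP : P ⊆ P') (v : M.Val) {s : S} (a : Term V s) :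
    ∀ d, a.Graph P v d → a.Graph P' v d := by
  induction a with
  | var s n => exact fun d h => h
  | app f a ih =>
    rintro d ⟨x, hx, hd⟩
    exact ⟨x, fun i => ih i _ (hx i), hP hd⟩

theorem Formula.Holds.mono {P P' N N' : Set (Atom M)} (hP : P ⊆ P') (hN : N' ⊆ N) (v : M.Val)
    (φ : Formula V) (h : φ.Holds P N v) : φ.Holds P' N' v := by
  induction φ generalizing P P' N N' v with
  | top => trivial
  | rel p a =>
    obtain ⟨x, hx, hd⟩ := h
    exact ⟨x, fun i => Term.Graph.mono hP v _ _ (hx i), hP hd⟩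
  | eq s a b =>
    obtain ⟨d, ha, hb⟩ := h
    exact ⟨d, Term.Graph.mono hP v _ _ ha, Term.Graph.mono hP v _ _ hb⟩
  | neg φ ih => exact fun h' => h (ih hN hP v h')
  | and φ ψ ihφ ihψ => exact ⟨ihφ hP hN v h.1, ihψ hP hN v h.2⟩
  | all s n φ ih => exact fun d => ih hP hN _ (h d)

theorem Head.Instance.mono {P P' : Set (Atom M)} (hP : P ⊆ P') (v : M.Val) (h : Head V)
    (a : Atom M) (ha : h.Instance P v a) : h.Instance P' v a := by
  cases h with
  | rel p t =>
    obtain ⟨x, hx, e⟩ := ha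
    exact ⟨x, fun i => Term.Graph.mono hP v _ _ (hx i), e⟩
  | fn f t b =>
    obtain ⟨x, d, hx, hd, e⟩ := ha
    exact ⟨x, d, fun i => Term.Graph.mono hP v _ _ (hx i), Term.Graph.mono hP v _ _ hd, e⟩

theorem Head.Instance.symbol_eq {P : Set (Atom M)} {v : M.Val} {h : Head V} {a : Atom M}
    (ha : h.Instance P v a) : a.symbol = h.symbol := by
  cases h with
  | rel p t => obtain ⟨x, _, rfl⟩ := ha; rfl
  | fn f t b => obtain ⟨x, d, _, _, rfl⟩ := ha; rfl

theorem derive_mono (Δ : Set (Rule V)) {P P' N N' : Set (Atom M)} (hP : P ⊆ P') (hN : N' ⊆ N) :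
    derive Δ P N ⊆ derive Δ P' N' := by
  rintro a (h | ⟨r, hr, v, hh, hb⟩)
  · exact .inl h
  · exact .inr ⟨r, hr, v, hh.mono hP, hb.mono hP hN⟩

theorem stable_subset {Δ : Set (Rule V)} {P N : Set (Atom M)} (h : derive Δ P N ⊆ P) :
    stable Δ N ⊆ P :=
  Set.sInter_subset_of_mem h

theorem derive_stable_subset (Δ : Set (Rule V)) (N : Set (Atom M)) :
    derive Δ (stable Δ N) N ⊆ stable Δ N :=
  fun _ ha _ hP => hP (derive_mono Δ (stable_subset hP) subset_rfl ha)

theorem stable_subset_derive (Δ : Set (Rule V)) (N : Set (Atom M)) :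
    stable Δ N ⊆ derive Δ (stable Δ N) N :=
  stable_subset (derive_mono Δ (derive_stable_subset Δ N) subset_rfl)

theorem stable_anti (Δ : Set (Rule V)) {N N' : Set (Atom M)} (hN : N' ⊆ N) :
    stable Δ N ⊆ stable Δ N' :=
  stable_subset ((derive_mono Δ subset_rfl hN).trans (derive_stable_subset Δ N'))

theorem wellFoundedTrue_subset {Δ : Set (Rule V)} {P : Set (Atom M)}
    (h : stable Δ (stable Δ P) ⊆ P) : wellFoundedTrue M Δ ⊆ P :=
  Set.sInter_subset_of_mem h

theorem stable_stable_wellFoundedTrue_subset (M : Str.{u, w} V) (Δ : Set (Rule V)) :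
    stable Δ (stable Δ (wellFoundedTrue M Δ)) ⊆ wellFoundedTrue M Δ :=
  fun _ ha _ hP => hP (stable_anti Δ (stable_anti Δ (wellFoundedTrue_subset hP)) ha)

/-- In a stable set the atoms of open symbols have the value they have in the structure. -/
theorem mem_stable_iff_of_not_defined {Δ : Set (Rule V)} {N : Set (Atom M)} {a : Atom M}
    (ha : ¬ Defined Δ a.symbol) : a ∈ stable Δ N ↔ a ∈ M.atoms := by
  constructor
  · intro h
    rcases stable_subset_derive Δ N h with h | ⟨r, hr, v, hh, -⟩
    · exact h.2
    · exact (ha ⟨r, hr, hh.symbol_eq.symm⟩).elim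
  · exact fun h => derive_stable_subset Δ N (.inl ⟨ha, h⟩)

/-- Transfer of satisfaction of a definition along a map `e` of domain atoms: it is enough that
the immediate consequences agree, on sets of atoms with a property `G` that the stable sets
have, up to keeping atoms in the range of `e` at the value that they have in the structure. -/
theorem Str.ModelsDef.transfer {S' : Type u} {V' : Voc S'} {M' : Str.{u, w} V'}
    {Δ : Set (Rule V)} {Δ' : Set (Rule V')} (hM : M.ModelsDef Δ) (e : Atom M' → Atom M)
    (he : ∀ b, e b ∈ M.atoms ↔ b ∈ M'.atoms) (G : Set (Atom M) → Prop)
    (hGs : ∀ N, G (stable Δ N))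
    (hGi : ∀ Z ⊆ M.atoms, (∀ a ∈ M.atoms, a ∉ Set.range e → a ∈ Z) → G Z)
    (hA : ∀ P N, G P → G N → ∀ b, ∀ r ∈ Δ', ∀ v : M'.Val, r.head.Instance (e ⁻¹' P) v b →
      r.body.Holds (e ⁻¹' P) (e ⁻¹' N) v → e b ∈ derive Δ P N)
    (hB : ∀ P N, G P → G N → ∀ b, e b ∈ M.atoms → e b ∈ derive Δ P N →
      b ∈ derive Δ' (e ⁻¹' P) (e ⁻¹' N)) :
    M'.ModelsDef Δ' := by
  have hX : stable Δ M.atoms = M.atoms := by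
    have h := hM.2
    rwa [wellFoundedPossible, hM.1] at h
  have hX' : e ⁻¹' M.atoms = M'.atoms := Set.ext he
  have hGX : G M.atoms := hX ▸ hGs M.atoms
  -- An atom open in `Δ'` may be defined in `Δ`. It is still derived there when true, because `N ⊆
  -- M.atoms` forces `stable Δ N` to contain all true atoms.
  have low : ∀ N, G N → N ⊆ M.atoms → stable Δ' (e ⁻¹' N) ⊆ e ⁻¹' stable Δ N := by
    intro N hN hNX
    have hXS : M.atoms ⊆ stable Δ N := hX.symm.subset.trans (stable_anti Δ hNX)
    refine stable_subset ?_
    rintro b (⟨-, hb⟩ | ⟨r, hr, v, hh, hb⟩)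
    · exact hXS ((he b).2 hb)
    · exact derive_stable_subset Δ N (hA _ _ (hGs N) hN b r hr v hh hb)
  have up : ∀ N, G N → M.atoms ⊆ N → e ⁻¹' stable Δ N ⊆ stable Δ' (e ⁻¹' N) := by
    intro N hN hNX
    -- The intersection with `M.atoms` is what makes `hB` applicable, since `hB` speaks of true
    -- atoms only. The condition on preimages is vacuous outside the range of `e`, so `Z` keeps
    -- every true atom there, as `hGi` demands.
    let Z : Set (Atom M) := {a | a ∈ M.atoms ∧ ∀ b, e b = a → b ∈ stable Δ' (e ⁻¹' N)}
    have hZX : Z ⊆ M.atoms := fun a ha => ha.1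
    have hZG : G Z := hGi Z hZX fun a ha hr => ⟨ha, fun b hb => (hr ⟨b, hb⟩).elim⟩
    have hZ : derive Δ Z N ⊆ Z := by
      intro a ha
      have haX : a ∈ M.atoms :=
        hX.subset (derive_stable_subset Δ _ (derive_mono Δ (hZX.trans hX.symm.subset) hNX ha))
      refine ⟨haX, ?_⟩
      rintro b rfl
      have hsub : e ⁻¹' Z ⊆ stable Δ' (e ⁻¹' N) := fun b hb => hb.2 b rfl
      exact derive_stable_subset Δ' _
        (derive_mono Δ' hsub subset_rfl (hB Z N hZG hN b haX ha))
    exact fun b hb => (stable_subset hZ hb).2 b rfl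
  have hY : stable Δ' M'.atoms = M'.atoms := by
    rw [← hX']
    refine ((low _ hGX subset_rfl).trans ?_).antisymm (Set.Subset.trans ?_ (up _ hGX subset_rfl))
    · rw [hX]
    · rw [hX]
  have hL : wellFoundedTrue M' Δ' = M'.atoms := by
    have hLY : wellFoundedTrue M' Δ' ⊆ M'.atoms := wellFoundedTrue_subset (by rw [hY, hY])
    refine hLY.antisymm ?_
    -- The candidate prefixpoint for `Δ`, built like `Z` above. Once it is closed under the squared
    -- stable operator it contains the well-founded model of `Δ`, which is all of `M.atoms`.
    let P : Set (Atom M) := {a | a ∈ M.atoms ∧ ∀ b, e b = a → b ∈ wellFoundedTrue M' Δ'}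
    have hPX : P ⊆ M.atoms := fun a ha => ha.1
    have hPG : G P := hGi P hPX fun a ha hr => ⟨ha, fun b hb => (hr ⟨b, hb⟩).elim⟩
    have hPL : e ⁻¹' P ⊆ wellFoundedTrue M' Δ' := fun b hb => hb.2 b rfl
    have hN : M.atoms ⊆ stable Δ P := hX.symm.subset.trans (stable_anti Δ hPX)
    have h1 : stable Δ' (wellFoundedTrue M' Δ') ⊆ e ⁻¹' stable Δ P :=
      (stable_anti Δ' hPL).trans (low P hPG hPX)
    -- `P` lies below the true atoms and `stable Δ P` above them, so `low` applies to the inner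
    -- stable operator and `up` to the outer one.
    have hP : stable Δ (stable Δ P) ⊆ P := by
      intro a ha
      refine ⟨hX.subset (stable_anti Δ hN ha), ?_⟩
      rintro b rfl
      exact stable_stable_wellFoundedTrue_subset M' Δ'
        (stable_anti Δ' h1 (up _ (hGs P) hN ha))
    intro b hb
    have hXP : M.atoms ⊆ P := hM.1.symm.subset.trans (wellFoundedTrue_subset hP)
    exact hPL (hXP ((he b).2 hb))
  exact ⟨hL, by rw [wellFoundedPossible, hL, hY]⟩

theorem Term.graph_atoms (v : M.Val) {s : S} (a : Term V s) :
    ∀ d, a.Graph M.atoms v d ↔ d = a.val v := by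
  induction a with
  | var s n => exact fun d => Iff.rfl
  | app f a ih =>
    intro d
    constructor
    · rintro ⟨x, hx, hd⟩
      have : x = fun i => (a i).val v := funext fun i => (ih i _).1 (hx i)
      subst this
      exact Eq.symm hd
    · rintro rfl
      exact ⟨_, fun i => (ih i _).2 rfl, rfl⟩

/-- Over the true atoms of a structure the evaluation of formulas is Tarskian truth. -/
theorem Formula.holds_atoms (v : M.Val) (φ : Formula V) :
    φ.Holds M.atoms M.atoms v ↔ φ.Sat v := by
  induction φ generalizing v with
  | top => exact Iff.rfl
  | rel p a =>
    constructor
    · rintro ⟨x, hx, hd⟩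
      have : x = fun i => (a i).val v := funext fun i => (Term.graph_atoms v _ _).1 (hx i)
      subst this
      exact hd
    · exact fun h => ⟨_, fun i => (Term.graph_atoms v _ _).2 rfl, h⟩
  | eq s a b => simp [Formula.Holds, Formula.Sat, Term.graph_atoms]
  | neg φ ih => exact not_congr (ih v)
  | and φ ψ ihφ ihψ => exact and_congr (ihφ v) (ihψ v)
  | all s n φ ih => exact forall_congr' fun d => ih _

theorem Term.val_congr {v v' : M.Val} {s : S} (a : Term V s)
    (h : ∀ p ∈ a.vars, v p.1 p.2 = v' p.1 p.2) : a.val v = a.val v' := by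
  induction a with
  | var s n => exact h (s, n) rfl
  | app f a ih =>
    have : (fun i => (a i).val v) = fun i => (a i).val v' :=
      funext fun i => ih i fun p hp => h p (Set.mem_iUnion.2 ⟨i, hp⟩)
    exact congrArg (M.fn f) this

theorem Str.Val.set_congr {v v' : M.Val} {s : S} {n : ℕ} (d : M.dom s) (p : S × ℕ)
    (h : p ≠ (s, n) → v p.1 p.2 = v' p.1 p.2) : v.set s n d p.1 p.2 = v'.set s n d p.1 p.2 := by
  classical
  obtain ⟨s', n'⟩ := p
  by_cases hs : s' = s
  · subst hs
    by_cases hn : n' = n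
    · subst hn; simp [Str.Val.set]
    · simpa [Str.Val.set, hn] using h
  · simpa [Str.Val.set, hs] using h

theorem Formula.sat_congr {v v' : M.Val} (φ : Formula V)
    (h : ∀ p ∈ φ.freeVars, v p.1 p.2 = v' p.1 p.2) : φ.Sat v ↔ φ.Sat v' := by
  induction φ generalizing v v' with
  | top => exact Iff.rfl
  | rel p a =>
    have : (fun i => (a i).val v) = fun i => (a i).val v' :=
      funext fun i => Term.val_congr _ fun q hq => h q (Set.mem_iUnion.2 ⟨i, hq⟩)
    exact iff_of_eq (congrArg (M.rel p) this)
  | eq s a b =>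
    have ha := Term.val_congr a fun q hq => h q (.inl hq)
    have hb := Term.val_congr b fun q hq => h q (.inr hq)
    simp only [Formula.Sat, ha, hb]
  | neg φ ih => exact not_congr (ih h)
  | and φ ψ ihφ ihψ =>
    exact and_congr (ihφ fun q hq => h q (.inl hq)) (ihψ fun q hq => h q (.inr hq))
  | all s n φ ih =>
    exact forall_congr' fun d => ih fun p hp =>
      Str.Val.set_congr d p fun hne => h p ⟨hp, hne⟩

end WellFounded

/-! ### Frozen structures and the elimination of time -/

section Correspondence

variable {V : LTVoc.{u}} {K : Type}

/-- The state structure whose copy `k` of the dynamic symbols is interpreted at time `τ k`. -/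
def TimeStr.states (J : TimeStr.{u, w} V) (τ : K → ℕ) : Str.{u, w} (V.state K) where
  dom := J.base.dom
  nonempty := J.base.nonempty
  rel
    | .static p => fun x => J.base.rel p x
    | .dyn p k => fun x => J.rel p x (τ k)
  fn
    | .static f => fun x => J.base.fn f x
    | .dyn f k => fun x => J.fn f x (τ k)

variable {J : TimeStr.{u, w} V} {τ : K → ℕ}

/-- Arguments of a dynamic symbol at a time point. -/
def TimeStr.withTime (J : TimeStr.{u, w} V) {ι : Type} {ty : ι → V.Ty} (n : ℕ)
    (x : ∀ i, J.base.dom (ty i)) : ∀ i : Option ι, J.dom (i.map ty)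
  | none => (⟨n⟩ : ULift.{w} ℕ)
  | some i => x i

theorem TimeStr.withTime_eta {ι : Type} {ty : ι → V.Ty} (x : ∀ i : Option ι, J.dom (i.map ty)) :
    J.withTime (ULift.down (x none)) (fun i => x (some i)) = x := by
  funext i
  cases i <;> rfl

/-- A domain atom of the state structure as a domain atom of the linear-time structure. -/
def liftAtom (τ : K → ℕ) : Atom (J.states τ) → Atom J.toStr
  | .rel (.static p) x => .rel (M := J.toStr) (FullRel.static p) x
  | .rel (.dyn p k) x => .rel (M := J.toStr) (FullRel.dyn p) (J.withTime (τ k) x)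
  | .fn (.static f) x d => .fn (M := J.toStr) (FullFn.static f) x d
  | .fn (.dyn f k) x d => .fn (M := J.toStr) (FullFn.dyn f) (J.withTime (τ k) x) d

theorem liftAtom_mem_atoms (b : Atom (J.states τ)) :
    liftAtom τ b ∈ J.toStr.atoms ↔ b ∈ (J.states τ).atoms := by
  rcases b with ⟨_ | _, x⟩ | ⟨_ | _, x, d⟩ <;> exact Iff.rfl

theorem preimage_atoms : liftAtom τ ⁻¹' J.toStr.atoms = (J.states τ).atoms :=
  Set.ext liftAtom_mem_atoms

/-- Symbols with a fixed interpretation. -/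
def IsTimeSymbol (σ : V.full.Rel ⊕ V.full.Fn) : Prop :=
  σ = .inr FullFn.init ∨ σ = .inr FullFn.succ

/-- A set of domain atoms that interprets the initial time point and the successor correctly. -/
def TimeCorrect (P : Set (Atom J.toStr)) : Prop :=
  ∀ a, IsTimeSymbol a.symbol → (a ∈ P ↔ a ∈ J.toStr.atoms)

theorem timeCorrect_atoms : TimeCorrect J.toStr.atoms := fun _ _ => Iff.rfl

theorem not_isTimeSymbol_liftAtom (b : Atom (J.states τ)) :
    ¬ IsTimeSymbol (liftAtom τ b).symbol := by
  rcases b with ⟨_ | _, x⟩ | ⟨_ | _, x, d⟩ <;> rintro (h | h) <;> cases h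

theorem timeCorrect_of_subset {Z : Set (Atom J.toStr)} (hZ : Z ⊆ J.toStr.atoms)
    (h : ∀ a ∈ J.toStr.atoms, a ∉ Set.range (liftAtom τ) → a ∈ Z) : TimeCorrect Z := by
  refine fun a ha => ⟨fun h' => hZ h', fun h' => h a h' ?_⟩
  rintro ⟨b, rfl⟩
  exact not_isTimeSymbol_liftAtom b ha

theorem not_defined_of_isTimeSymbol {T : Theory V.full} (hT : T.IsLTC)
    {σ : V.full.Rel ⊕ V.full.Fn} (hσ : IsTimeSymbol σ) : ¬ Defined T.rules σ := by
  rintro ⟨r, hr, rfl⟩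
  have := hT.stratified r hr
  obtain ⟨h | ⟨f, a, b⟩, body⟩ := r
  · rcases hσ with h | h <;> cases h
  · rcases hσ with h | h <;> cases h <;> exact this

/-- The symbols for the initial time point and the successor head no rule, hence are open. This is
why time terms can be evaluated as usual in every set of atoms that the stable operator produces. -/
theorem timeCorrect_stable {T : Theory V.full} (hT : T.IsLTC) (N : Set (Atom J.toStr)) :
    TimeCorrect (stable T.rules N) :=
  fun _ ha => mem_stable_iff_of_not_defined (not_defined_of_isTimeSymbol hT ha)

/-- Only variables, the initial time point and the successor can build a time term, and `P` is
correct on these symbols. The type is kept as a variable with `s = none` so that induction on the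
indexed family applies. -/
theorem Term.graph_time {P : Set (Atom J.toStr)} (hP : TimeCorrect P) (v : J.toStr.Val)
    {s : Option V.Ty} (a : Term V.full s) (hs : s = none) :
    ∀ d, a.Graph P v d ↔ d = a.val v := by
  induction a with
  | var s n => exact fun d => Iff.rfl
  | app f a ih =>
    intro d
    have key : ∀ x, IsTimeSymbol (.inr f : V.full.Rel ⊕ V.full.Fn) →
        ((Atom.fn f x d ∈ P) ↔ J.toStr.fn f x = d) := fun x hf => hP (.fn f x d) hf
    have args : ∀ i, V.full.fnTy f i = none ∧
        IsTimeSymbol (.inr f : V.full.Rel ⊕ V.full.Fn) := by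
      cases f with
      | init => exact fun i => i.elim
      | succ => exact fun i => ⟨rfl, .inr rfl⟩
      | static f => cases hs
      | dyn f => cases hs
    have hf : IsTimeSymbol (.inr f : V.full.Rel ⊕ V.full.Fn) := by
      cases f with
      | init => exact .inl rfl
      | succ => exact .inr rfl
      | static f => cases hs
      | dyn f => cases hs
    constructor
    · rintro ⟨x, hx, hd⟩
      have : x = fun i => (a i).val v := funext fun i => (ih i (args i).1 _).1 (hx i)
      subst this
      exact ((key _ hf).1 hd).symm
    · rintro rfl
      exact ⟨_, fun i => (ih i (args i).1 _).2 rfl, (key _ hf).2 rfl⟩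

theorem Term.val_time_congr {v v' : J.toStr.Val} (h : v none = v' none) {s : Option V.Ty}
    (a : Term V.full s) (hs : s = none) : a.val v = a.val v' := by
  induction a with
  | var s n => subst hs; exact congrFun h n
  | app f a ih =>
    have args : ∀ i, V.full.fnTy f i = none := by
      cases f with
      | init => exact fun i => i.elim
      | succ => exact fun i => rfl
      | static f => cases hs
      | dyn f => cases hs
    exact congrArg (J.toStr.fn f) (funext fun i => ih i (args i))

/-- The state (current or next) to which a time term refers after a substitution. -/
def TimeTerm.step (ι : TimeTerm V) (ρ : ℕ → TimeTerm V) (σ : TimeTerm V) : Step :=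
  ULift.down (Term.te (K := Unit) (fun _ => ()) (Term.timeSubst ι ρ σ))

/-- Elimination reads only the outermost symbol of a time term, so the naming `κ` of the copies
plays no role. Hence `TimeTerm.step` may be computed with a one-element index type. -/
theorem Term.te_down_eq {K' : Type} (κ : Step → K) (κ' : Step → K') {s : Option V.Ty}
    (a : Term V.full s) :
    match s, a with
    | none, a => (ULift.down (Term.te κ a) : Step) = ULift.down (Term.te κ' a)
    | some _, _ => True := by
  cases a with
  | var s n => cases s <;> trivial
  | app f a => cases f <;> trivial

theorem Term.te_timeSubst_down (κ : Step → K) (ι : TimeTerm V) (ρ : ℕ → TimeTerm V)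
    (σ : TimeTerm V) : ULift.down (Term.te κ (Term.timeSubst ι ρ σ)) = TimeTerm.step ι ρ σ :=
  Term.te_down_eq κ (fun _ => ()) (Term.timeSubst ι ρ σ)

/-- Each of the given time terms has the value that its state has under `τ`. -/
structure Aligned (κ : Step → K) (τ : K → ℕ) (ι : TimeTerm V) (ρ : ℕ → TimeTerm V)
    (v : J.toStr.Val) (Θ : Set (TimeTerm V)) : Prop where
  val : ∀ σ ∈ Θ, (ULift.down (Term.val v σ) : ℕ) = τ (κ (TimeTerm.step ι ρ σ))
  -- Needed for equations between time terms, whose elimination compares states instead of time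
  -- points. It is automatic for a singleton `Θ`, even where `κ` identifies the two states.
  inj : ∀ σ ∈ Θ, ∀ σ' ∈ Θ, τ (κ (TimeTerm.step ι ρ σ)) = τ (κ (TimeTerm.step ι ρ σ')) →
    TimeTerm.step ι ρ σ = TimeTerm.step ι ρ σ'

variable {κ : Step → K} {ι : TimeTerm V} {ρ : ℕ → TimeTerm V} {v : J.toStr.Val}

theorem Aligned.mono {Θ Θ' : Set (TimeTerm V)} (h : Aligned κ τ ι ρ v Θ) (hΘ : Θ' ⊆ Θ) :
    Aligned κ τ ι ρ v Θ' :=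
  ⟨fun σ hσ => h.val σ (hΘ hσ), fun σ hσ σ' hσ' => h.inj σ (hΘ hσ) σ' (hΘ hσ')⟩

theorem Aligned.congr {v' : J.toStr.Val} {Θ : Set (TimeTerm V)} (h : Aligned κ τ ι ρ v Θ)
    (hv : v' none = v none) : Aligned κ τ ι ρ v' Θ :=
  ⟨fun σ hσ => by rw [← h.val σ hσ, Term.val_time_congr hv σ rfl], h.inj⟩

/-- The values of the variables of the types other than `Time`. -/
def stateVal (τ : K → ℕ) (v : J.toStr.Val) : (J.states τ).Val := fun s n => v (some s) n

/-- All time variables get the value `m`. -/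
def timeVal (m : ℕ) (v : (J.states τ).Val) : J.toStr.Val
  | none => fun _ => (⟨m⟩ : ULift.{w} ℕ)
  | some s => v s

theorem stateVal_set (s : V.Ty) (n : ℕ) (d : J.base.dom s) :
    stateVal τ (Str.Val.set (M := J.toStr) v (some s) n d) =
      Str.Val.set (M := J.states τ) (stateVal τ v) s n d := by
  funext s' n'
  by_cases hs : s' = s
  · subst hs
    simp only [stateVal, Str.Val.set, Function.update_self]
    rfl
  · have hs' : (some s' : Option V.Ty) ≠ some s := fun h => hs (Option.some.inj h)
    simp only [stateVal, Str.Val.set, ne_eq, hs, hs', not_false_eq_true, Function.update_of_ne]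
    rfl

theorem set_some_none (s : V.Ty) (n : ℕ) (d : J.base.dom s) :
    Str.Val.set (M := J.toStr) v (some s) n d none = v none := by
  simp [Str.Val.set]

theorem Term.mem_timeTerms_self (σ : TimeTerm V) : σ ∈ Term.timeTerms σ := by
  have : ∀ {s : Option V.Ty} (a : Term V.full s), Term.self a ⊆ a.timeTerms := by
    intro s a
    cases a with
    | var s n => exact subset_rfl
    | app f a => exact Set.subset_union_left
  exact this σ rfl

/-- Correspondence of the values of a term before and after the elimination of time. -/
def Term.Corresponds (κ : Step → K) (τ : K → ℕ) (ι : TimeTerm V) (ρ : ℕ → TimeTerm V)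
    (P : Set (Atom J.toStr)) (v : J.toStr.Val) : (s : Option V.Ty) → Term V.full s → Prop
  | none, _ => True
  | some s, a => ∀ d : J.base.dom s, a.Graph P v d ↔
      Term.Graph (liftAtom τ ⁻¹' P) (stateVal τ v)
        (Term.te κ (Term.timeSubst ι ρ a) : Term (V.state K) s) d

/-- Evaluation of the arguments of a dynamic symbol before and after the elimination of time. -/
theorem exists_graph_dyn_iff {P : Set (Atom J.toStr)} (hP : TimeCorrect P) {β : Type}
    {ty : β → V.Ty} (a : ∀ i : Option β, Term V.full (i.map ty))
    (ha : ∀ i, Term.Corresponds κ τ ι ρ P v _ (a (some i)))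
    (h0 : Aligned κ τ ι ρ v (a none).timeTerms) (Q : (∀ i : Option β, J.dom (i.map ty)) → Prop) :
    (∃ x : ∀ i : Option β, J.dom (i.map ty),
      (∀ i, Term.Graph (M := J.toStr) P v (a i) (x i)) ∧ Q x) ↔
    ∃ y : ∀ i, J.base.dom (ty i),
      (∀ i, Term.Graph (liftAtom τ ⁻¹' P) (stateVal τ v)
        (Term.te κ (Term.timeSubst ι ρ (a (some i))) : Term (V.state K) (ty i)) (y i)) ∧
      Q (J.withTime (τ (κ (ULift.down (Term.te κ (Term.timeSubst ι ρ (a none)))))) y) := by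
  have h0 : (ULift.down (Term.val v (a none)) : ℕ) =
      τ (κ (ULift.down (Term.te κ (Term.timeSubst ι ρ (a none))))) :=
    (h0.val _ (Term.mem_timeTerms_self _)).trans
      (congrArg (fun k => τ (κ k)) (Term.te_timeSubst_down κ ι ρ (a none)).symm)
  rw [← h0]
  constructor
  · rintro ⟨x, hx, hQ⟩
    refine ⟨fun i => x (some i), fun i => (ha i _).1 (hx (some i)), ?_⟩
    -- The time argument is forced to be the value of its term, so only the other arguments remain
    -- to be chosen.
    have hx0 : x none = Term.val v (a none) := (Term.graph_time hP v (a none) rfl _).1 (hx none)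
    rw [← hx0, TimeStr.withTime_eta]
    exact hQ
  · rintro ⟨y, hy, hQ⟩
    refine ⟨_, fun i => ?_, hQ⟩
    cases i with
    | none => exact (Term.graph_time hP v (a none) rfl _).2 rfl
    | some i => exact (ha i _).2 (hy i)

theorem Term.corresponds {P : Set (Atom J.toStr)} (hP : TimeCorrect P) {s : Option V.Ty}
    (a : Term V.full s) (ha : Aligned κ τ ι ρ v a.timeTerms) :
    Term.Corresponds κ τ ι ρ P v s a := by
  induction a with
  | var s n =>
    cases s with
    | none => trivial
    | some s => exact fun d => Iff.rfl
  | app f a ih =>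
    have hargs : ∀ i, Aligned κ τ ι ρ v (a i).timeTerms := fun i =>
      ha.mono fun σ hσ => Or.inr (Set.mem_iUnion.2 ⟨i, hσ⟩)
    cases f with
    | init => trivial
    | succ => trivial
    | static f =>
      intro d
      exact exists_congr fun x => and_congr (forall_congr' fun i => ih i (hargs i) (x i)) Iff.rfl
    | dyn f =>
      exact fun d => exists_graph_dyn_iff hP a (fun i => ih (some i) (hargs (some i)))
        (hargs none) fun x => Atom.fn (M := J.toStr) (FullFn.dyn f) x d ∈ P

theorem holds_teTimeEq_iff {P N : Set (Atom (J.states τ))} {w : (J.states τ).Val} (k k' : Step) :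
    (teTimeEq k k' : Formula (V.state K)).Holds P N w ↔ k = k' := by
  cases k <;> cases k' <;> simp [teTimeEq, Formula.Holds]

/-- Correspondence of the values of a formula before and after the elimination of time. -/
theorem Formula.holds_te_iff {P N : Set (Atom J.toStr)} (hP : TimeCorrect P) (hN : TimeCorrect N)
    (φ : Formula V.full) (hφ : ∀ n, (none, n) ∉ φ.boundVars)
    (ha : Aligned κ τ ι ρ v φ.timeTerms) :
    φ.Holds P N v ↔ ((φ.timeSubst ι ρ).te κ).Holds (liftAtom τ ⁻¹' P) (liftAtom τ ⁻¹' N)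
      (stateVal τ v) := by
  induction φ generalizing P N v with
  | top => exact Iff.rfl
  | rel p a =>
    have hargs : ∀ i, Aligned κ τ ι ρ v (a i).timeTerms := fun i =>
      ha.mono fun σ hσ => Set.mem_iUnion.2 ⟨i, hσ⟩
    cases p with
    | static p =>
      exact exists_congr fun x => and_congr
        (forall_congr' fun i => Term.corresponds hP (a i) (hargs i) (x i)) Iff.rfl
    | dyn p =>
      exact exists_graph_dyn_iff hP a (fun i => Term.corresponds hP _ (hargs (some i)))
        (hargs none) fun x => Atom.rel (M := J.toStr) (FullRel.dyn p) x ∈ P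
  | eq s a b =>
    cases s with
    | none =>
      have hma : a ∈ (Formula.eq none a b).timeTerms := .inl (Term.mem_timeTerms_self a)
      have hmb : b ∈ (Formula.eq none a b).timeTerms := .inr (Term.mem_timeTerms_self b)
      refine Iff.trans ?_ (holds_teTimeEq_iff _ _).symm
      rw [Term.te_timeSubst_down, Term.te_timeSubst_down]
      constructor
      · rintro ⟨d, hda, hdb⟩
        have e : Term.val v a = Term.val v b := ((Term.graph_time hP v a rfl d).1 hda).symm.trans
          ((Term.graph_time hP v b rfl d).1 hdb)
        exact ha.inj _ hma _ hmb
          ((ha.val _ hma).symm.trans ((congrArg ULift.down e).trans (ha.val _ hmb)))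
      · intro e
        refine ⟨Term.val v a, (Term.graph_time hP v a rfl _).2 rfl,
          (Term.graph_time hP v b rfl _).2 (ULift.down_injective ?_)⟩
        exact (ha.val _ hma).trans ((congrArg (fun k => τ (κ k)) e).trans (ha.val _ hmb).symm)
    | some s =>
      exact exists_congr fun d => and_congr
        (Term.corresponds hP a (ha.mono Set.subset_union_left) d)
        (Term.corresponds hP b (ha.mono Set.subset_union_right) d)
  | neg φ ih => exact not_congr (ih hN hP hφ ha)
  | and φ ψ ihφ ihψ =>
    exact and_congr
      (ihφ hP hN (fun n h => hφ n (.inl h)) (ha.mono Set.subset_union_left))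
      (ihψ hP hN (fun n h => hφ n (.inr h)) (ha.mono Set.subset_union_right))
  | all s n φ ih =>
    cases s with
    -- Time quantifiers inside the formula are excluded; the outer `∀ t` is stripped off before this
    -- lemma is used.
    | none => exact (hφ n (.inl rfl)).elim
    | some s =>
      refine forall_congr' fun d => ?_
      exact (ih hP hN (fun m h => hφ m (.inr h))
        ((ha.mono Set.subset_union_right).congr (set_some_none s n d))).trans
        (iff_of_eq (congrArg (fun w => Formula.Holds (liftAtom τ ⁻¹' P) (liftAtom τ ⁻¹' N) w
          ((φ.timeSubst ι ρ).te κ)) (stateVal_set s n d)))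

theorem TimeStr.withTime_inj {β : Type} {ty : β → V.Ty} {m n : ℕ}
    {x y : ∀ i, J.base.dom (ty i)} (h : J.withTime m x = J.withTime n y) : m = n ∧ x = y :=
  ⟨congrArg ULift.down (congrFun h none), funext fun i => congrFun h (some i)⟩

theorem liftAtom_injective (hτ : Function.Injective τ) :
    Function.Injective (liftAtom τ : Atom (J.states τ) → Atom J.toStr) := by
  rintro (⟨p | ⟨p, k⟩, x⟩ | ⟨f | ⟨f, k⟩, x, d⟩) (⟨q | ⟨q, l⟩, y⟩ | ⟨g | ⟨g, l⟩, y, c⟩) h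
  · cases h; rfl
  · cases (Atom.rel.inj h).1
  · cases h
  · cases h
  · cases (Atom.rel.inj h).1
  · obtain ⟨hp, hx⟩ := Atom.rel.inj h
    cases hp
    obtain ⟨hk, rfl⟩ := TimeStr.withTime_inj (eq_of_heq hx)
    cases hτ hk; rfl
  · cases h
  · cases h
  · cases h
  · cases h
  · cases h; rfl
  · cases (Atom.fn.inj h).1
  · cases h
  · cases h
  · cases (Atom.fn.inj h).1
  · obtain ⟨hf, hx, hd⟩ := Atom.fn.inj h
    cases hf; cases hd
    obtain ⟨hk, rfl⟩ := TimeStr.withTime_inj (eq_of_heq hx)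
    cases hτ hk; rfl

/-- Correspondence of the instances of a rule head before and after the elimination of time. -/
theorem Head.instance_te_iff {P : Set (Atom J.toStr)} (hP : TimeCorrect P)
    (hτ : Function.Injective τ) (h : Head V.full) (body : Formula V.full)
    (ha : Aligned κ τ ι ρ v h.timeTerms) (b : Atom (J.states τ)) :
    h.Instance P v (liftAtom τ b) ↔
      ∃ h', ((Rule.timeSubst ι ρ ⟨h, body⟩).head.te κ) = some h' ∧
        h'.Instance (liftAtom τ ⁻¹' P) (stateVal τ v) b := by
  have inj : ∀ b' : Atom (J.states τ), liftAtom τ b = liftAtom τ b' ↔ b = b' := fun b' =>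
    (liftAtom_injective hτ).eq_iff
  have some_iff : ∀ (h₀ : Head (V.state K)) (Q : Head (V.state K) → Prop),
      (∃ h', some h₀ = some h' ∧ Q h') ↔ Q h₀ := by simp
  cases h with
  | rel p a =>
    have hargs : ∀ i, Aligned κ τ ι ρ v (a i).timeTerms := fun i =>
      ha.mono fun σ hσ => Set.mem_iUnion.2 ⟨i, hσ⟩
    cases p with
    | static p =>
      refine Iff.trans ?_ (some_iff _ _).symm
      exact exists_congr fun x => and_congr
        (forall_congr' fun i => Term.corresponds hP (a i) (hargs i) (x i))
        (inj (.rel (M := J.states τ) (StateRel.static p) x))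
    | dyn p =>
      refine Iff.trans ?_ (some_iff _ _).symm
      refine (exists_graph_dyn_iff hP a (fun i => Term.corresponds hP _ (hargs (some i)))
        (hargs none) fun x => liftAtom τ b = Atom.rel (M := J.toStr) (FullRel.dyn p) x).trans ?_
      exact exists_congr fun x => and_congr Iff.rfl
        (inj (.rel (M := J.states τ) (StateRel.dyn p _) x))
  | fn f a c =>
    have hargs : ∀ i, Aligned κ τ ι ρ v (a i).timeTerms := fun i =>
      ha.mono fun σ hσ => .inl (.inr (Set.mem_iUnion.2 ⟨i, hσ⟩))
    have hc : Term.Corresponds κ τ ι ρ P v _ c :=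
      Term.corresponds hP c (ha.mono Set.subset_union_right)
    cases f with
    | init =>
      -- Neither side can hold: no lifted atom has a time symbol, and elimination of such a head is
      -- `none`.
      refine iff_of_false ?_ (by rintro ⟨h', h, -⟩; cases h)
      rintro ⟨x, d, -, -, e⟩
      exact not_isTimeSymbol_liftAtom b (e ▸ .inl rfl)
    | succ =>
      refine iff_of_false ?_ (by rintro ⟨h', h, -⟩; cases h)
      rintro ⟨x, d, -, -, e⟩
      exact not_isTimeSymbol_liftAtom b (e ▸ .inr rfl)
    | static f =>
      refine Iff.trans ?_ (some_iff _ _).symm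
      exact exists_congr fun x => exists_congr fun d => and_congr
        (forall_congr' fun i => Term.corresponds hP (a i) (hargs i) (x i))
        (and_congr (hc d) (inj (.fn (M := J.states τ) (StateFn.static f) x d)))
    | dyn f =>
      refine Iff.trans ?_ (some_iff _ _).symm
      refine Iff.trans (exists_congr fun x => exists_and_left) (Iff.trans ?_
        (exists_congr fun x => exists_and_left).symm)
      refine (exists_graph_dyn_iff hP a (fun i => Term.corresponds hP _ (hargs (some i)))
        (hargs none) fun x => ∃ d, Term.Graph P v c d ∧
          liftAtom τ b = Atom.fn (M := J.toStr) (FullFn.dyn f) x d).trans ?_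
      exact exists_congr fun x => and_congr Iff.rfl (exists_congr fun d =>
        and_congr (hc d) (inj (.fn (M := J.states τ) (StateFn.dyn f _) x d)))

/-- Correspondence of rule applications before and after the elimination of time. -/
theorem Rule.apply_te_iff {P N : Set (Atom J.toStr)} (hP : TimeCorrect P) (hN : TimeCorrect N)
    (hτ : Function.Injective τ) (r : Rule V.full) (hr : ∀ n, (none, n) ∉ r.body.boundVars)
    (ha : Aligned κ τ ι ρ v r.timeTerms) (b : Atom (J.states τ)) :
    (r.head.Instance P v (liftAtom τ b) ∧ r.body.Holds P N v) ↔
      ∃ r', (r.timeSubst ι ρ).te κ = some r' ∧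
        r'.head.Instance (liftAtom τ ⁻¹' P) (stateVal τ v) b ∧
        r'.body.Holds (liftAtom τ ⁻¹' P) (liftAtom τ ⁻¹' N) (stateVal τ v) := by
  rw [Head.instance_te_iff hP hτ r.head r.body (ha.mono Set.subset_union_left),
    Formula.holds_te_iff hP hN r.body hr (ha.mono Set.subset_union_right)]
  constructor
  · rintro ⟨⟨h', hh, hi⟩, hb⟩
    exact ⟨⟨h', _⟩, by rw [Rule.te, hh]; rfl, hi, hb⟩
  · rintro ⟨r', hr', hi, hb⟩
    obtain ⟨h', hh, rfl⟩ := Option.map_eq_some_iff.1 hr'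
    exact ⟨⟨h', hh, hi⟩, hb⟩

/-- Correspondence of truth before and after the elimination of time. -/
theorem Formula.sat_te_iff (φ : Formula V.full) (hφ : ∀ n, (none, n) ∉ φ.boundVars)
    (ha : Aligned κ τ ι ρ v φ.timeTerms) :
    φ.Sat v ↔ ((φ.timeSubst ι ρ).te κ).Sat (stateVal τ v) := by
  rw [← Formula.holds_atoms, Formula.holds_te_iff timeCorrect_atoms timeCorrect_atoms φ hφ ha,
    preimage_atoms, Formula.holds_atoms]

end Correspondence

/-! ### Kinds of rules, time arguments of heads, and stratification -/

section Kinds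

variable {V : LTVoc.{u}} {K : Type} {κ : Step → K} {ι : TimeTerm V} {ρ : ℕ → TimeTerm V}

/-- With this, elimination with and without a preceding substitution falls under the same
correspondence lemmas. -/
theorem Term.timeSubst_id {s : Option V.Ty} (a : Term V.full s) :
    Term.timeSubst initial timeVar a = a := by
  induction a with
  | var s n => cases s <;> rfl
  | app f a ih =>
    have : (fun i => Term.timeSubst initial timeVar (a i)) = a := funext ih
    cases f with
    | init => exact congrArg (Term.app (V := V.full) FullFn.init) (funext fun i => i.elim)
    | succ => exact congrArg (Term.app (V := V.full) FullFn.succ) this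
    | static f => exact congrArg (Term.app (V := V.full) (FullFn.static f)) this
    | dyn f => exact congrArg (Term.app (V := V.full) (FullFn.dyn f)) this

theorem Formula.timeSubst_id (φ : Formula V.full) : φ.timeSubst initial timeVar = φ := by
  induction φ <;> simp_all [Formula.timeSubst, Term.timeSubst_id]

theorem Rule.timeSubst_id (r : Rule V.full) : r.timeSubst initial timeVar = r := by
  obtain ⟨_ | _, _⟩ := r <;>
    simp [Rule.timeSubst, Formula.timeSubst_id, Term.timeSubst_id]

theorem Formula.mem_timeTerms_of_mem_boundVars {n : ℕ} (φ : Formula V.full)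
    (h : (none, n) ∈ φ.boundVars) : timeVar n ∈ φ.timeTerms := by
  induction φ with
  | top => exact h
  | rel p a => exact h.elim
  | eq s a b => exact h.elim
  | neg φ ih => exact ih h
  | and φ ψ ihφ ihψ => exact h.imp ihφ ihψ
  | all s m φ ih =>
    rcases h with h | h
    · cases h; exact .inl rfl
    · exact .inr (ih h)

/-- The time argument of the symbol that a rule head defines. -/
def Head.time : Head V.full → Option (TimeTerm V)
  | .rel (.dyn _) a => some (a none)
  | .fn (.dyn _) a _ => some (a none)
  | _ => none

/-- The symbol of the linear-time vocabulary of which a state symbol is a copy. -/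
def liftSymbol : (V.state K).Rel ⊕ (V.state K).Fn → V.full.Rel ⊕ V.full.Fn
  | .inl (.static p) => .inl (FullRel.static p)
  | .inl (.dyn p _) => .inl (FullRel.dyn p)
  | .inr (.static f) => .inr (FullFn.static f)
  | .inr (.dyn f _) => .inr (FullFn.dyn f)

/-- The index of the copy that a state symbol is. -/
def copyIndex : (V.state K).Rel ⊕ (V.state K).Fn → Option K
  | .inl (.dyn _ k) => some k
  | .inr (.dyn _ k) => some k
  | _ => none

theorem liftAtom_symbol {J : TimeStr.{u, w} V} {τ : K → ℕ} (b : Atom (J.states τ)) :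
    (liftAtom τ b).symbol = liftSymbol b.symbol := by
  rcases b with ⟨_ | _, x⟩ | ⟨_ | _, x, d⟩ <;> rfl

theorem Rule.liftSymbol_te {r : Rule V.full} {r' : Rule (V.state K)}
    (h : (r.timeSubst ι ρ).te κ = some r') : liftSymbol r'.head.symbol = r.head.symbol := by
  obtain ⟨⟨_ | _, a⟩ | ⟨_ | _ | _ | _, a, b⟩, body⟩ := r <;> cases h <;> rfl

theorem Rule.copyIndex_te {r : Rule V.full} {r' : Rule (V.state K)}
    (h : (r.timeSubst ι ρ).te κ = some r') :
    copyIndex r'.head.symbol = r.head.time.map fun σ => κ (TimeTerm.step ι ρ σ) := by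
  obtain ⟨⟨_ | _, a⟩ | ⟨_ | _ | _ | _, a, b⟩, body⟩ := r <;> cases h <;>
    first
    | rfl
    | exact congrArg (fun s => some (κ s)) (Term.te_timeSubst_down κ ι ρ _)

/-- A rule instance fixes the time point of the atom it derives. This restricts the copies a given
rule can contribute to; for static symbols both sides are `none`. -/
theorem Head.time_instance {J : TimeStr.{u, w} V} {τ : K → ℕ} {P : Set (Atom J.toStr)}
    (hP : TimeCorrect P) {v : J.toStr.Val} {h : Head V.full} {b : Atom (J.states τ)}
    (hb : h.Instance P v (liftAtom τ b)) :
    h.time.map (fun σ : TimeTerm V => (ULift.down (Term.val v σ : J.dom none) : ℕ)) =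
      (copyIndex b.symbol).map τ := by
  have time_eq : ∀ {σ : TimeTerm V} {d : J.dom none}, Term.Graph (M := J.toStr) P v σ d →
      Term.val v σ = d := fun hσ => ((Term.graph_time hP v _ rfl _).1 hσ).symm
  rcases h with ⟨p | p, a⟩ | ⟨_ | _ | f | f, a, c⟩
  · obtain ⟨x, hx, e⟩ := hb
    rcases b with ⟨q | ⟨q, k⟩, y⟩ | ⟨g | ⟨g, k⟩, y, e⟩ <;> cases e
    rfl
  · obtain ⟨x, hx, e⟩ := hb
    rcases b with ⟨q | ⟨q, k⟩, y⟩ | ⟨g | ⟨g, k⟩, y, e⟩ <;> cases e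
    exact congrArg (fun z : J.dom none => some (ULift.down z : ℕ)) (time_eq (hx none))
  · obtain ⟨x, d, hx, -, e⟩ := hb
    rcases b with ⟨q | ⟨q, k⟩, y⟩ | ⟨g | ⟨g, k⟩, y, e⟩ <;> cases e
  · obtain ⟨x, d, hx, -, e⟩ := hb
    rcases b with ⟨q | ⟨q, k⟩, y⟩ | ⟨g | ⟨g, k⟩, y, e⟩ <;> cases e
  · obtain ⟨x, d, hx, -, e⟩ := hb
    rcases b with ⟨q | ⟨q, k⟩, y⟩ | ⟨g | ⟨g, k⟩, y, e⟩ <;> cases e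
    rfl
  · obtain ⟨x, d, hx, -, e⟩ := hb
    rcases b with ⟨q | ⟨q, k⟩, y⟩ | ⟨g | ⟨g, k⟩, y, e⟩ <;> cases e
    exact congrArg (fun z : J.dom none => some (ULift.down z : ℕ)) (time_eq (hx none))

theorem Rule.mem_timeTerms_of_time {r : Rule V.full} {σ : TimeTerm V}
    (h : r.head.time = some σ) : σ ∈ r.timeTerms := by
  obtain ⟨⟨_ | _, a⟩ | ⟨_ | _ | _ | _, a, b⟩, body⟩ := r <;> cases h
  · exact .inl (Set.mem_iUnion.2 ⟨none, Term.mem_timeTerms_self _⟩)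
  · exact .inl (.inl (.inr (Set.mem_iUnion.2 ⟨none, Term.mem_timeTerms_self _⟩)))

theorem Rule.RespectsTime.time_ne_none {r : Rule V.full} (hr : r.RespectsTime) {n : ℕ}
    (hn : timeVar n ∈ r.timeTerms) : r.head.time ≠ none := by
  obtain ⟨⟨_ | _, a⟩ | ⟨_ | _ | _ | _, a, b⟩, body⟩ := r
  · exact (hr n hn).elim
  · exact nofun
  · exact hr.elim
  · exact hr.elim
  · exact (hr n hn).elim
  · exact nofun

theorem Rule.RespectsTime.successor_notMem {r : Rule V.full} (hr : r.RespectsTime) {n : ℕ}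
    (hn : r.head.time = some (timeVar n)) : successor (timeVar n) ∉ r.timeTerms := by
  obtain ⟨⟨_ | _, a⟩ | ⟨_ | _ | _ | _, a, b⟩, body⟩ := r
  · cases hn
  · exact hr n (Option.some.inj hn)
  · exact hr.elim
  · exact hr.elim
  · cases hn
  · exact hr n (Option.some.inj hn)

theorem Rule.IsSingleState.time_eq {r : Rule V.full} {t : ℕ} (h : r.IsSingleState t)
    (hr : r.RespectsTime) : r.head.time = some (timeVar t) := by
  have hne := hr.time_ne_none (n := t) (by rw [h.2]; rfl)
  obtain ⟨σ, hσ⟩ := Option.ne_none_iff_exists'.1 hne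
  have := Rule.mem_timeTerms_of_time hσ
  rw [h.2] at this
  rw [hσ, this]

/-- Stratification enters here. A time variable in the rule excludes a static head, and an
occurrence of `S(t)` excludes a head at `t`, leaving only `S(t)`. -/
theorem Rule.IsBistate.isSingleState_or {r : Rule V.full} {t : ℕ} (h : r.IsBistate t)
    (hr : r.RespectsTime) : r.IsSingleState t ∨
      (r.head.time = some (successor (timeVar t)) ∧ successor (timeVar t) ∈ r.timeTerms) := by
  by_cases hs : successor (timeVar t) ∈ r.timeTerms
  · right
    refine ⟨?_, hs⟩
    obtain ⟨σ, hσ⟩ := Option.ne_none_iff_exists'.1 (hr.time_ne_none h.2.1)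
    rcases h.2.2 (Rule.mem_timeTerms_of_time hσ) with rfl | rfl
    · exact (hr.successor_notMem hσ hs).elim
    · exact hσ
  · left
    refine ⟨h.1, Set.Subset.antisymm (fun σ hσ => ?_) (Set.singleton_subset_iff.2 h.2.1)⟩
    rcases h.2.2 hσ with rfl | rfl
    · rfl
    · exact (hs hσ).elim

theorem initial_ne_timeVar (n : ℕ) : (initial : TimeTerm V) ≠ timeVar n := nofun

theorem successor_ne_timeVar (σ : TimeTerm V) (n : ℕ) : successor σ ≠ timeVar n := nofun

theorem Formula.notMem_boundVars {φ : Formula V.full} {Θ : Set (TimeTerm V)} {t : ℕ}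
    (ht : (none, t) ∉ φ.boundVars) (hφ : φ.timeTerms ⊆ Θ) (hΘ : ∀ n, timeVar n ∈ Θ → n = t)
    (n : ℕ) : (none, n) ∉ φ.boundVars := by
  intro h
  obtain rfl := hΘ n (hφ (Formula.mem_timeTerms_of_mem_boundVars φ h))
  exact ht h

theorem eq_of_timeVar_mem {n t : ℕ}
    (h : timeVar n ∈ ({timeVar t, successor (timeVar t)} : Set (TimeTerm V))) : n = t := by
  rcases h with h | h
  · cases h; rfl
  · exact (successor_ne_timeVar _ _ (Eq.symm h)).elim

end Kinds

/-! ### Frozen structures are models of the initial and transition theories -/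

section Theories

variable {V : LTVoc.{u}} {K : Type} {κ : Step → K} {ι : TimeTerm V} {ρ : ℕ → TimeTerm V}
  {J : TimeStr.{u, w} V} {τ : K → ℕ}

/-- The time points of the current and the next state. -/
def stepTime (k : ℕ) : Step → ℕ
  | .cur => k
  | .next => k + 1

theorem stepTime_injective (k : ℕ) : Function.Injective (stepTime k) := by
  rintro (_ | _) (_ | _) h <;> simp_all [stepTime]

theorem step_shift (t : ℕ) : TimeTerm.step (V := V) initial (shift t) (timeVar t) = .next := by
  have : shift (V := V) t t = successor (timeVar t) := if_pos rfl
  change ULift.down (Term.te (K := Unit) (fun _ => ()) (shift (V := V) t t)) = _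
  rw [this]
  rfl

theorem aligned_empty (v : J.toStr.Val) : Aligned κ τ ι ρ v ∅ :=
  ⟨fun _ h => h.elim, fun _ h => h.elim⟩

theorem aligned_singleton {v : J.toStr.Val} {σ : TimeTerm V}
    (h : (ULift.down (Term.val v σ : J.dom none) : ℕ) = τ (κ (TimeTerm.step ι ρ σ))) :
    Aligned κ τ ι ρ v {σ} :=
  ⟨by rintro _ rfl; exact h, by rintro _ rfl _ rfl _; rfl⟩

theorem aligned_initial (v : J.toStr.Val) :
    Aligned (fun _ => ()) (fun _ => 0) (timeVar 0) timeVar v {initial} :=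
  aligned_singleton rfl

theorem aligned_single {v : J.toStr.Val} {t : ℕ}
    (h : (ULift.down (v none t : J.dom none) : ℕ) = 0) :
    Aligned (fun _ => ()) (fun _ => 0) initial timeVar v {timeVar t} :=
  aligned_singleton h

theorem aligned_bistate {v : J.toStr.Val} {t k : ℕ}
    (h : (ULift.down (v none t : J.dom none) : ℕ) = k) :
    Aligned id (stepTime k) initial timeVar v {timeVar t, successor (timeVar t)} where
  val := by
    rintro σ (rfl | rfl)
    · exact h
    · exact congrArg (· + 1) h
  inj _ _ _ _ e := stepTime_injective k e

/-- The shift turns `t` into `S(t)`, which refers to the next state, so `t` itself must have the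
value `k + 1`. -/
theorem aligned_next {v : J.toStr.Val} {t k : ℕ}
    (h : (ULift.down (v none t : J.dom none) : ℕ) = k + 1) :
    Aligned id (stepTime k) initial (shift t) v {timeVar t} :=
  aligned_singleton (by rw [step_shift]; exact h)

theorem notMem_boundVars_of_timeTerms {φ : Formula V.full} (h : ∀ n, timeVar n ∉ φ.timeTerms)
    (n : ℕ) : (none, n) ∉ φ.boundVars :=
  fun hn => h n (Formula.mem_timeTerms_of_mem_boundVars φ hn)

theorem Rule.IsStatic.notMem_boundVars {r : Rule V.full} (h : r.IsStatic) (n : ℕ) :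
    (none, n) ∉ r.body.boundVars :=
  notMem_boundVars_of_timeTerms (fun n hn => by
    have : timeVar n ∈ r.timeTerms := .inr hn
    rw [h] at this; exact this) n

theorem Rule.IsInitial.notMem_boundVars {r : Rule V.full} (h : r.IsInitial) (n : ℕ) :
    (none, n) ∉ r.body.boundVars :=
  notMem_boundVars_of_timeTerms (fun n hn => by
    have : timeVar n ∈ r.timeTerms := .inr hn
    rw [h] at this; exact initial_ne_timeVar n this.symm) n

theorem Rule.IsSingleState.isBistate {r : Rule V.full} {t : ℕ} (h : r.IsSingleState t) :
    r.IsBistate t :=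
  ⟨h.1, by rw [h.2]; rfl, by rw [h.2]; exact Set.singleton_subset_iff.2 (.inl rfl)⟩

theorem Rule.IsBistate.notMem_boundVars {r : Rule V.full} {t : ℕ} (h : r.IsBistate t) (n : ℕ) :
    (none, n) ∉ r.body.boundVars :=
  Formula.notMem_boundVars h.1 (Set.subset_union_right.trans h.2.2) (fun _ => eq_of_timeVar_mem) n

theorem Rule.IsBistate.not_isStatic {r : Rule V.full} {t : ℕ} (h : r.IsBistate t) :
    ¬ r.IsStatic := fun hs => by
  have := h.2.1
  rw [hs] at this
  exact this

theorem Rule.IsInitial.not_isStatic {r : Rule V.full} (h : r.IsInitial) : ¬ r.IsStatic :=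
  fun hs => Set.singleton_ne_empty _ (h.symm.trans hs)

theorem Rule.IsInitial.not_isSingleState {r : Rule V.full} (h : r.IsInitial) (t : ℕ) :
    ¬ r.IsSingleState t := fun hs =>
  initial_ne_timeVar t (Set.singleton_eq_singleton_iff.1 (h.symm.trans hs.2))

theorem mem_derive_lift {P N : Set (Atom J.toStr)} (hP : TimeCorrect P) (hN : TimeCorrect N)
    (hτ : Function.Injective τ) {Δ : Set (Rule V.full)} {r : Rule V.full} (hr : r ∈ Δ)
    (hb : ∀ n, (none, n) ∉ r.body.boundVars) {v : J.toStr.Val}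
    (ha : Aligned κ τ ι ρ v r.timeTerms) {b : Atom (J.states τ)} {r' : Rule (V.state K)}
    (h : (r.timeSubst ι ρ).te κ = some r')
    (hi : r'.head.Instance (liftAtom τ ⁻¹' P) (stateVal τ v) b)
    (hh : r'.body.Holds (liftAtom τ ⁻¹' P) (liftAtom τ ⁻¹' N) (stateVal τ v)) :
    liftAtom τ b ∈ derive Δ P N :=
  .inr ⟨r, hr, v, (Rule.apply_te_iff hP hN hτ r hb ha b).2 ⟨r', h, hi, hh⟩⟩

theorem mem_derive_te {P N : Set (Atom J.toStr)} (hP : TimeCorrect P) (hN : TimeCorrect N)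
    (hτ : Function.Injective τ) {Δ : Set (Rule (V.state K))} {r : Rule V.full}
    (hb : ∀ n, (none, n) ∉ r.body.boundVars) {v : J.toStr.Val}
    (ha : Aligned κ τ ι ρ v r.timeTerms)
    (hΔ : ∀ r', (r.timeSubst ι ρ).te κ = some r' → r' ∈ Δ) {b : Atom (J.states τ)}
    (hi : r.head.Instance P v (liftAtom τ b)) (hh : r.body.Holds P N v) :
    b ∈ derive Δ (liftAtom τ ⁻¹' P) (liftAtom τ ⁻¹' N) := by
  obtain ⟨r', h, hi', hh'⟩ := (Rule.apply_te_iff hP hN hτ r hb ha b).1 ⟨hi, hh⟩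
  exact .inr ⟨r', hΔ r' h, _, hi', hh'⟩

/-- If a dynamic atom is an instance of a rule head, the two time points agree. -/
theorem exists_copyIndex {P : Set (Atom J.toStr)} (hP : TimeCorrect P) {v : J.toStr.Val}
    {h : Head V.full} {b : Atom (J.states τ)} (hb : h.Instance P v (liftAtom τ b))
    {σ : TimeTerm V} (hσ : h.time = some σ) :
    ∃ c, copyIndex b.symbol = some c ∧ (ULift.down (Term.val v σ : J.dom none) : ℕ) = τ c := by
  have := Head.time_instance hP hb
  rw [hσ] at this
  obtain ⟨c, hc, e⟩ := Option.map_eq_some_iff.1 this.symm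
  exact ⟨c, hc, e.symm⟩

variable {T : Theory V.full}

theorem symbol_eq_of_te {r : Rule V.full} {r' : Rule (V.state K)} {b : Atom (J.states τ)}
    (h : (r.timeSubst ι ρ).te κ = some r') (hs : r'.head.symbol = b.symbol) :
    r.head.symbol = (liftAtom τ b).symbol := by
  rw [liftAtom_symbol, ← hs, Rule.liftSymbol_te h]

/-- The rules of the initial theory, with the substitution made explicit. -/
theorem mem_initialTheory_rules {r' : Rule V.single} (h : r' ∈ T.initialTheory.rules) :
    ∃ r ∈ T.rules,
      (r.IsStatic ∧ (r.timeSubst initial timeVar).teSingle = some r') ∨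
      (r.IsInitial ∧ (r.timeSubst (timeVar 0) timeVar).teSingle = some r') ∨
      ((∃ t, r.IsSingleState t) ∧ (r.timeSubst initial timeVar).teSingle = some r') := by
  simp_rw [Rule.timeSubst_id]
  exact h

/-- A single-state rule is also a bistate rule, so its unshifted copy is absorbed into the bistate
case and only the shifted copy needs its own. -/
theorem mem_transitionTheory_rules {r' : Rule V.bi} (h : r' ∈ T.transitionTheory.rules) :
    ∃ r ∈ T.rules,
      (r.IsStatic ∧ (r.timeSubst initial timeVar).teBi = some r') ∨
      (∃ t, r.IsSingleState t ∧ (r.timeSubst initial (shift t)).teBi = some r') ∨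
      ((∃ t, r.IsBistate t) ∧ (r.timeSubst initial timeVar).teBi = some r') := by
  simp_rw [Rule.timeSubst_id]
  obtain ⟨r, hr, h | ⟨t, h, h' | h'⟩ | h⟩ := h
  · exact ⟨r, hr, .inl h⟩
  · exact ⟨r, hr, .inr (.inr ⟨⟨t, h.isBistate⟩, h'⟩)⟩
  · exact ⟨r, hr, .inr (.inl ⟨t, h, h'⟩)⟩
  · exact ⟨r, hr, .inr (.inr h)⟩

theorem modelsDef_initialTheory (hT : T.IsLTC) (hJ : J.toStr.ModelsDef T.rules) :
    (J.states fun _ : Unit => 0).ModelsDef T.initialTheory.rules := by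
  have hτ : Function.Injective (fun _ : Unit => 0) := fun _ _ _ => rfl
  refine hJ.transfer (liftAtom _) liftAtom_mem_atoms TimeCorrect (timeCorrect_stable hT)
    (fun Z hZ h => timeCorrect_of_subset hZ h) ?_ ?_
  · intro P N hP hN b r' hr' v hi hh
    obtain ⟨r, hr, ⟨hk, h⟩ | ⟨hk, h⟩ | ⟨⟨t, hk⟩, h⟩⟩ := mem_initialTheory_rules hr'
    · exact mem_derive_lift (v := timeVal 0 v) hP hN hτ hr hk.notMem_boundVars
        (by rw [hk]; exact aligned_empty _) h hi hh
    · exact mem_derive_lift (v := timeVal 0 v) hP hN hτ hr hk.notMem_boundVars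
        (by rw [hk]; exact aligned_initial _) h hi hh
    · exact mem_derive_lift (v := timeVal 0 v) hP hN hτ hr hk.isBistate.notMem_boundVars
        (by rw [hk.2]; exact aligned_single rfl) h hi hh
  · rintro P N hP hN b hbX (⟨ho, -⟩ | ⟨r, hr, v, hi, hh⟩)
    · refine .inl ⟨?_, (liftAtom_mem_atoms b).1 hbX⟩
      rintro ⟨r', hr', hs⟩
      obtain ⟨r, hr, ⟨-, h⟩ | ⟨-, h⟩ | ⟨-, h⟩⟩ := mem_initialTheory_rules hr' <;>
        exact ho ⟨r, hr, symbol_eq_of_te h hs⟩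
    · have single : ∀ t, r.IsSingleState t →
          b ∈ derive T.initialTheory.rules (liftAtom (fun _ => 0) ⁻¹' P)
            (liftAtom (fun _ => 0) ⁻¹' N) := by
        intro t hk
        obtain ⟨c, -, hc⟩ := exists_copyIndex hP hi (hk.time_eq (hT.stratified r hr))
        exact mem_derive_te (κ := fun _ => ()) (Δ := T.initialTheory.rules)
          (ι := initial) (ρ := timeVar) hP hN hτ hk.isBistate.notMem_boundVars
          (by rw [hk.2]; exact aligned_single hc)
          (fun r' h => ⟨r, hr, .inr (.inr ⟨⟨t, hk⟩, by rwa [Rule.timeSubst_id] at h⟩)⟩) hi hh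
      rcases hT.rules r hr with hk | hk | ⟨t, hk⟩ | ⟨t, hk⟩
      · exact mem_derive_te (κ := fun _ => ()) (Δ := T.initialTheory.rules)
          (ι := initial) (ρ := timeVar) hP hN hτ hk.notMem_boundVars
          (by rw [hk]; exact aligned_empty _)
          (fun r' h => ⟨r, hr, .inl ⟨hk, by rwa [Rule.timeSubst_id] at h⟩⟩) hi hh
      · exact mem_derive_te (κ := fun _ => ()) (Δ := T.initialTheory.rules)
          (ι := timeVar 0) (ρ := timeVar) hP hN hτ hk.notMem_boundVars
          (by rw [hk]; exact aligned_initial _)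
          (fun r' h => ⟨r, hr, .inr (.inl ⟨hk, h⟩)⟩) hi hh
      · exact single t hk
      · rcases hk.isSingleState_or (hT.stratified r hr) with hk' | ⟨ht, -⟩
        · exact single t hk'
        · obtain ⟨c, -, hc⟩ := exists_copyIndex hP hi ht
          -- A head at `S(t)` cannot yield an atom at time 0, so leaving bistate rules out of the
          -- initial theory loses nothing.
          exact (Nat.succ_ne_zero _ hc).elim

/-- Atoms derived by initial or proper bistate rules only have a rule of the transition theory
if they belong to the next state. -/
theorem not_defined_transitionTheory (hT : T.IsLTC) (hsep : T.SeparatesRules) {r : Rule V.full}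
    (hr : r ∈ T.rules) (hs : ¬ r.IsStatic) (hss : ∀ t, ¬ r.IsSingleState t)
    {τ : Step → ℕ} {b : Atom (J.states τ)} (hb : (liftAtom τ b).symbol = r.head.symbol)
    (hn : copyIndex b.symbol ≠ some .next) : ¬ Defined T.transitionTheory.rules b.symbol := by
  rintro ⟨r', hr', e⟩
  obtain ⟨q, hq, h⟩ := mem_transitionTheory_rules hr'
  have sep : q.head.symbol = r.head.symbol →
      (¬ q.IsStatic) ∧ ∀ t, ¬ q.IsSingleState t := by
    intro he
    have := hsep q hq r hr he
    exact ⟨fun h => hs (this.1 h), fun t h => (this.2 ⟨t, h⟩).elim hss⟩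
  rcases h with ⟨hk, h⟩ | ⟨t, hk, h⟩ | ⟨⟨t, hk⟩, h⟩
  · exact (sep ((symbol_eq_of_te h e).trans hb)).1 hk
  · exact (sep ((symbol_eq_of_te h e).trans hb)).2 t hk
  · rcases hk.isSingleState_or (hT.stratified q hq) with hk' | ⟨ht, -⟩
    · exact (sep ((symbol_eq_of_te h e).trans hb)).2 t hk'
    -- The only remaining rules for this symbol have their head at `S(t)`, and these define the
    -- next-state copy alone.
    · refine hn ?_
      rw [← e, Rule.copyIndex_te h, ht]
      rfl

theorem modelsDef_transitionTheory (hT : T.IsLTC) (hsep : T.SeparatesRules)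
    (hJ : J.toStr.ModelsDef T.rules) (k : ℕ) :
    (J.states (stepTime k)).ModelsDef T.transitionTheory.rules := by
  have hτ := stepTime_injective k
  refine hJ.transfer (liftAtom _) liftAtom_mem_atoms TimeCorrect (timeCorrect_stable hT)
    (fun Z hZ h => timeCorrect_of_subset hZ h) ?_ ?_
  · intro P N hP hN b r' hr' v hi hh
    obtain ⟨r, hr, ⟨hk, h⟩ | ⟨t, hk, h⟩ | ⟨⟨t, hk⟩, h⟩⟩ := mem_transitionTheory_rules hr'
    · exact mem_derive_lift (v := timeVal 0 v) hP hN hτ hr hk.notMem_boundVars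
        (by rw [hk]; exact aligned_empty _) h hi hh
    · exact mem_derive_lift (v := timeVal (k + 1) v) hP hN hτ hr hk.isBistate.notMem_boundVars
        (by rw [hk.2]; exact aligned_next rfl) h hi hh
    · exact mem_derive_lift (v := timeVal k v) hP hN hτ hr hk.notMem_boundVars
        ((aligned_bistate (v := timeVal k v) rfl).mono hk.2.2) h hi hh
  · rintro P N hP hN b hbX (⟨ho, -⟩ | ⟨r, hr, v, hi, hh⟩)
    · refine .inl ⟨?_, (liftAtom_mem_atoms b).1 hbX⟩
      rintro ⟨r', hr', hs⟩
      obtain ⟨r, hr, ⟨-, h⟩ | ⟨t, -, h⟩ | ⟨-, h⟩⟩ := mem_transitionTheory_rules hr' <;>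
        exact ho ⟨r, hr, symbol_eq_of_te h hs⟩
    · have hopen : ¬ r.IsStatic → (∀ t, ¬ r.IsSingleState t) →
          copyIndex b.symbol ≠ some .next →
          b ∈ derive T.transitionTheory.rules (liftAtom (stepTime k) ⁻¹' P)
            (liftAtom (stepTime k) ⁻¹' N) := fun hs hss hn =>
        .inl ⟨not_defined_transitionTheory hT hsep hr hs hss hi.symbol_eq hn,
          (liftAtom_mem_atoms b).1 hbX⟩
      have bistate : ∀ t, r.IsBistate t → (ULift.down (v none t : J.dom none) : ℕ) = k →
          b ∈ derive T.transitionTheory.rules (liftAtom (stepTime k) ⁻¹' P)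
            (liftAtom (stepTime k) ⁻¹' N) := fun t hk hv =>
        mem_derive_te (κ := id) (Δ := T.transitionTheory.rules)
          (ι := initial) (ρ := timeVar) hP hN hτ hk.notMem_boundVars
          ((aligned_bistate hv).mono hk.2.2)
          (fun r' h => ⟨r, hr, .inr (.inr ⟨⟨t, hk⟩, by rwa [Rule.timeSubst_id] at h⟩)⟩) hi hh
      have single : ∀ t, r.IsSingleState t →
          b ∈ derive T.transitionTheory.rules (liftAtom (stepTime k) ⁻¹' P)
            (liftAtom (stepTime k) ⁻¹' N) := by
        intro t hk
        obtain ⟨c, -, hc⟩ := exists_copyIndex hP hi (hk.time_eq (hT.stratified r hr))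
        -- The head is at `t`, so `t` is `k` or `k + 1`: the plain copy of the rule serves the first
        -- case and the shifted copy the second.
        cases c with
        | cur => exact bistate t hk.isBistate hc
        | next =>
          exact mem_derive_te (κ := id) (Δ := T.transitionTheory.rules)
            (ι := initial) (ρ := shift t) hP hN hτ hk.isBistate.notMem_boundVars
            (by rw [hk.2]; exact aligned_next hc)
            (fun r' h => ⟨r, hr, .inr (.inl ⟨t, hk, .inr h⟩)⟩) hi hh
      rcases hT.rules r hr with hk | hk | ⟨t, hk⟩ | ⟨t, hk⟩
      · exact mem_derive_te (κ := id) (Δ := T.transitionTheory.rules)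
          (ι := initial) (ρ := timeVar) hP hN hτ hk.notMem_boundVars
          (by rw [hk]; exact aligned_empty _)
          (fun r' h => ⟨r, hr, .inl ⟨hk, by rwa [Rule.timeSubst_id] at h⟩⟩) hi hh
      -- An initial rule derives static atoms or atoms at time 0, never atoms at `k + 1`.
      · refine hopen hk.not_isStatic hk.not_isSingleState fun hn => ?_
        have hti := Head.time_instance hP hi
        rw [hn] at hti
        obtain ⟨σ, hσ, e⟩ := Option.map_eq_some_iff.1 hti
        have hmem := Rule.mem_timeTerms_of_time hσ
        rw [hk] at hmem
        obtain rfl : σ = initial := hmem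
        exact Nat.succ_ne_zero k e.symm
      · exact single t hk
      · rcases hk.isSingleState_or (hT.stratified r hr) with hk' | ⟨ht, hmem⟩
        · exact single t hk'
        -- The head is at `S(t)`. For an atom at `k` the body would refer to time `k - 1`, outside
        -- the two states, so the atom is treated as open; for one at `k + 1`, `t` is `k`.
        · obtain ⟨c, hbc, hc⟩ := exists_copyIndex hP hi ht
          cases c with
          | cur =>
            refine hopen hk.not_isStatic (fun t' hk' => ?_) (by rw [hbc]; nofun)
            rw [hk'.2] at hmem
            exact successor_ne_timeVar _ _ hmem
          | next => exact bistate t hk (Nat.succ.inj hc)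

theorem models_te (φ : Formula V.full) (hφ : ∀ n, timeVar n ∉ φ.timeTerms)
    (ha : ∀ v : (J.states τ).Val, Aligned κ τ ι ρ (timeVal 0 v) φ.timeTerms)
    (h : J.toStr.Models φ) : (J.states τ).Models ((φ.timeSubst ι ρ).te κ) := fun v =>
  (Formula.sat_te_iff φ (notMem_boundVars_of_timeTerms hφ) (ha v)).1 (h _)

theorem Str.Val.set_self {S : Type u} {V : Voc S} {M : Str.{u, w} V} (v : M.Val) (s : S) (n : ℕ) :
    v.set s n (v s n) = v := by
  simp [Str.Val.set]

/-- Truth at the time point `m` before and after the elimination of time. -/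
theorem Formula.IsUniversal.sat_te_iff {t m : ℕ} {φ' : Formula V.full} {Θ : Set (TimeTerm V)}
    (hb : (none, t) ∉ φ'.boundVars) (hΘ : (Formula.all none t φ').timeTerms ⊆ Θ)
    (ht : ∀ n, timeVar n ∈ Θ → n = t) (v : (J.states τ).Val)
    (ha : Aligned κ τ ι ρ (timeVal m v) Θ) :
    φ'.Sat (timeVal m v) ↔ (((Formula.all none t φ').timeSubst ι ρ).te κ).Sat v :=
  have hs : φ'.timeTerms ⊆ Θ := Set.subset_union_right.trans hΘ
  Formula.sat_te_iff φ' (Formula.notMem_boundVars hb hs ht) (ha.mono hs)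

theorem Formula.IsUniversal.models_te {t m : ℕ} {φ : Formula V.full} {Θ : Set (TimeTerm V)}
    (hu : φ.IsUniversal t) (hΘ : φ.timeTerms ⊆ Θ) (ht : ∀ n, timeVar n ∈ Θ → n = t)
    (ha : ∀ v : (J.states τ).Val, Aligned κ τ ι ρ (timeVal m v) Θ)
    (h : J.toStr.Models φ) : (J.states τ).Models ((φ.timeSubst ι ρ).te κ) := by
  obtain ⟨φ', rfl, hb⟩ := hu
  intro v
  rw [← Formula.IsUniversal.sat_te_iff hb hΘ ht v (ha v)]
  -- Instantiating `t` with the value it already has leaves the assignment unchanged.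
  have := h (timeVal m v) (timeVal m v none t)
  rwa [Str.Val.set_self] at this

theorem Formula.IsSingleState.isBistate {φ : Formula V.full} {t : ℕ} (h : φ.IsSingleState t) :
    φ.IsBistate t :=
  ⟨h.1, by rw [h.2]; rfl, by rw [h.2]; exact Set.singleton_subset_iff.2 (.inl rfl)⟩

theorem eq_of_timeVar_mem_singleton {n t : ℕ} (h : timeVar n ∈ ({timeVar t} : Set (TimeTerm V))) :
    n = t :=
  eq_of_timeVar_mem (.inl h)

theorem Formula.IsStatic.timeVar_notMem {φ : Formula V.full} (h : φ.IsStatic) (n : ℕ) :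
    timeVar n ∉ φ.timeTerms := by
  rw [h]; exact Set.notMem_empty _

theorem modelsTheory_initialTheory (hT : T.IsLTC) (hJ : J.toStr.ModelsTheory T) :
    (J.states fun _ : Unit => 0).ModelsTheory T.initialTheory := by
  refine ⟨?_, modelsDef_initialTheory hT hJ.2⟩
  rintro ψ ⟨φ, hφ, ⟨hk, rfl⟩ | ⟨hk, rfl⟩ | ⟨⟨t, hk⟩, rfl⟩⟩
  · rw [← Formula.timeSubst_id φ]
    exact models_te φ hk.timeVar_notMem (fun v => by rw [hk]; exact aligned_empty _) (hJ.1 φ hφ)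
  · refine models_te φ (fun n hn => ?_) (fun v => by rw [hk]; exact aligned_initial _) (hJ.1 φ hφ)
    rw [hk] at hn
    exact initial_ne_timeVar n (Eq.symm hn)
  · rw [← Formula.timeSubst_id φ]
    exact hk.1.models_te (m := 0) hk.2.subset (fun _ => eq_of_timeVar_mem_singleton)
      (fun v => aligned_single rfl) (hJ.1 φ hφ)

theorem modelsTheory_transitionTheory (hT : T.IsLTC) (hsep : T.SeparatesRules)
    (hJ : J.toStr.ModelsTheory T) (k : ℕ) :
    (J.states (stepTime k)).ModelsTheory T.transitionTheory := by
  refine ⟨?_, modelsDef_transitionTheory hT hsep hJ.2 k⟩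
  have bistate : ∀ t, ∀ φ ∈ T.sentences, φ.IsBistate t →
      (J.states (stepTime k)).Models φ.teBi := by
    intro t φ hφ hk
    rw [← Formula.timeSubst_id φ]
    exact hk.1.models_te (m := k) hk.2.2 (fun _ => eq_of_timeVar_mem)
      (fun v => aligned_bistate rfl) (hJ.1 φ hφ)
  rintro ψ ⟨φ, hφ, ⟨hk, rfl⟩ | ⟨t, hk, rfl | rfl⟩ | ⟨⟨t, hk⟩, rfl⟩⟩
  · rw [← Formula.timeSubst_id φ]
    exact models_te φ hk.timeVar_notMem (fun v => by rw [hk]; exact aligned_empty _) (hJ.1 φ hφ)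
  · exact bistate t φ hφ hk.isBistate
  · exact hk.1.models_te (m := k + 1) hk.2.subset (fun _ => eq_of_timeVar_mem_singleton)
      (fun v => aligned_next rfl) (hJ.1 φ hφ)
  · exact bistate t φ hφ hk

end Theories

end LTC

/-! ### Induction over time -/

theorem mainTheorem6 {V : LTC.LTVoc.{u}} (T : LTC.Theory V.full) (hT : T.IsLTC)
    (hsep : T.SeparatesRules) (I : LTC.Str.{u, w} V.static)
    (t : ℕ) (φ : LTC.Formula V.full) (hφ : φ.IsSentence) (hφt : φ.IsSingleState t)
    (h0 : ¬ ∃ M : LTC.Str.{u, w} V.single, M.Expands I ∧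
      M.ModelsTheory (T.initialTheory.and (.neg φ.teSingle)))
    (ht : ¬ ∃ M : LTC.Str.{u, w} V.bi, M.Expands I ∧
      M.ModelsTheory ((T.transitionTheory.and φ.teBi).and (.neg (φ.atNext t).teBi))) :
    ∀ J : LTC.TimeStr.{u, w} V, J.Expands I → J.toStr.ModelsTheory T → J.toStr.Models φ := by
  rintro J rfl hJ
  obtain ⟨⟨φ', rfl, hb⟩, hΘ⟩ := hφt
  -- As `φ` is closed, the truth of `φ'` depends on the value of `t` only. A counterexample under
  -- one assignment is then one under all, as being a model of the negated sentence requires.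
  have congr : ∀ v v' : J.toStr.Val, v none t = v' none t → (φ'.Sat v ↔ φ'.Sat v') := by
    intro v v' h
    refine φ'.sat_congr fun p hp => ?_
    by_cases hpt : p = (none, t)
    · rw [hpt]; exact h
    · have : p ∈ (LTC.Formula.all (V := V.full) none t φ').freeVars := ⟨hp, hpt⟩
      rw [hφ] at this
      exact this.elim
  have uniq : ∀ n, LTC.timeVar n ∈ ({LTC.timeVar t} : Set (LTC.TimeTerm V)) → n = t :=
    fun _ => LTC.eq_of_timeVar_mem_singleton
  -- The assignments range over the non-time types of `J` and do not involve `τ`, so the same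
  -- statement serves the single-state and the bistate structures.
  have key : ∀ k, ∀ v : ∀ s, ℕ → J.base.dom s,
      φ'.Sat (LTC.timeVal (J := J) (τ := fun _ : Unit => 0) k v) := by
    intro k
    induction k with
    | zero =>
      by_contra hne
      obtain ⟨v, hv⟩ := not_forall.1 hne
      refine h0 ⟨J.states fun _ => 0, rfl, ?_, (LTC.modelsTheory_initialTheory hT hJ).2⟩
      rintro ψ (rfl | hψ)
      · intro v' hv'
        refine hv ((congr (LTC.timeVal 0 v') (LTC.timeVal 0 v) (Eq.refl _)).1
          ((LTC.Formula.IsUniversal.sat_te_iff hb hΘ.subset uniq v'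
          (LTC.aligned_single (v := LTC.timeVal 0 v') rfl)).2 ?_))
        rw [LTC.Formula.timeSubst_id]
        exact hv'
      · exact (LTC.modelsTheory_initialTheory hT hJ).1 ψ hψ
    | succ k ih =>
      by_contra hne
      obtain ⟨v, hv⟩ := not_forall.1 hne
      have hM := LTC.modelsTheory_transitionTheory hT hsep hJ k
      refine ht ⟨J.states (LTC.stepTime k), rfl, ?_, hM.2⟩
      rintro ψ (rfl | rfl | hψ)
      · intro v' hv'
        exact hv ((congr (LTC.timeVal (k + 1) v') (LTC.timeVal (k + 1) v) (Eq.refl _)).1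
          ((LTC.Formula.IsUniversal.sat_te_iff hb hΘ.subset uniq v'
          (LTC.aligned_next (v := LTC.timeVal (k + 1) v') rfl)).2 hv'))
      · intro v'
        rw [← LTC.Formula.timeSubst_id (LTC.Formula.all (V := V.full) none t φ')]
        exact (LTC.Formula.IsUniversal.sat_te_iff hb
          (hΘ.subset.trans (Set.singleton_subset_iff.2 (.inl rfl)))
          (fun _ => LTC.eq_of_timeVar_mem) v'
          (LTC.aligned_bistate (v := LTC.timeVal k v') rfl)).1 ((congr _ _ rfl).1 (ih v'))
      · exact hM.1 ψ hψ
  intro v d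
  -- `timeVal` sends every time variable to the same point; by `congr` only its value at `t`
  -- matters.
  refine (congr _ _ ?_).1 (key (ULift.down d) fun s => v (some s))
  simp [LTC.Str.Val.set]
  rfl
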